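/- Let $\lambda>0$, $P_u>0$, $\alpha_I>2$, $h>0$, let $m_I\ge 1$ be an integer, and put $\delta_I=2/\alpha_I$. UAVs are located at height $h$ above the ground; their horizontal positions form a homogeneous Poisson point process $\Psi$ of density $\lambda$ on the plane $\mathbb{R}^2$. The typical user is at the origin of the ground, so the $j$-th UAV, with horizontal position $x_j$, is at distance $d_j=\sqrt{h^2+\|x_j\|^2}$ from it. The small-scale power gains $|g_j|^2$ are independent of each other and of $\Psi$ and have the density $f(x)=\frac{m_I^{m_I}x^{m_I-1}}{\Gamma(m_I)}e^{-m_Ix}$, $x\ge 0$ (Nakagami fading with parameter $m_I$). For a serving distance $r_t=\sqrt{h^2+r^2}$, where $r\ge 0$ is the horizontal distance between the user and its serving UAV, the interference (which is taken to be the same for the typical user and the user paired with it) is $$I=\sum_{j\in\Psi,\ d_j>r_t}|g_j|^2P_u\,d_j^{-\alpha_I}.$$ Write $$\mathcal{L}_t(s;r_t)=\exp\left(-\frac{2\pi\lambda}{\alpha_I}\sum_{i=1}^{m_I}\binom{m_I}{i}\left(\frac{sP_u}{m_I}\right)^{\delta_I}(-1)^{\delta_I-i}\,B\left(\frac{-sP_u}{m_Ir_t^{\alpha_I}};\,i-\delta_I,\,1-m_I\right)\right),$$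 where $B(z;a,b)=\int_0^z t^{a-1}(1-t)^{b-1}\,dt$ is the incomplete Beta function, integrated along the segment from $0$ to $z$, and complex powers are principal values. Then: (1) for every fixed $r\ge 0$, the series $I$ converges almost surely, and $\mathbb{E}\left[e^{-sI}\right]=\mathcal{L}_t(s;r_t)$ for all real $s\ge 0$; (2) in the user-centric strategy, where the serving UAV is the nearest one, so that $r=\min_j\|x_j\|$ and $r_t=\sqrt{h^2+r^2}$ are random, the series $I$ converges almost surely, and for every real $s\ge 0$ the Laplace transform of $I$ conditional on the serving distance is $\mathbb{E}\left[e^{-sI}\mid r\right]=\mathcal{L}_t(s;r_t)$ almost surely. -/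

import Mathlib

open MeasureTheory ProbabilityTheory

/-- The horizontal plane, with its Euclidean norm and Lebesgue measure. -/
abbrev Plane : Type := EuclideanSpace ℝ (Fin 2)

/-- The number of indices `j` with `X j ω ∈ A`, that is, the number of points (with multiplicity) of
the point configuration enumerated by `j ↦ X j ω` that lie in `A`. -/
noncomputable def pointCount {Ω : Type*} (X : ℕ → Ω → Plane) (A : Set Plane) (ω : Ω) : ℕ∞ :=
  {j : ℕ | X j ω ∈ A}.encard

/-- `X` enumerates the points of a homogeneous Poisson point process of density `lam` on the plane:
the number of points in a Borel set `A` of finite area is Poisson distributed with mean `lam * |A|`,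
and the numbers of points in finitely many disjoint such sets are independent.
(For `lam > 0` such a process has infinitely many points almost surely, so that it can be
enumerated by `ℕ`.) -/
structure IsHomogeneousPoissonProcess {Ω : Type*} [MeasurableSpace Ω] (μ : Measure Ω) (lam : ℝ)
    (X : ℕ → Ω → Plane) : Prop where
  measurable : ∀ j, Measurable (X j)
  count_law : ∀ A : Set Plane, MeasurableSet A → volume A ≠ ⊤ →
    HasLaw (pointCount X A)
      ((poissonMeasure (lam * volume.real A).toNNReal).map (Nat.cast : ℕ → ℕ∞)) μ
  count_indep : ∀ (n : ℕ) (A : Fin n → Set Plane), (∀ k, MeasurableSet (A k)) →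
    (∀ k, volume (A k) ≠ ⊤) → Pairwise (fun k l => Disjoint (A k) (A l)) →
    iIndepFun (fun k => pointCount X (A k)) μ

/-- Small-scale Nakagami fading power gains with parameter `m`, attached to the points `X`:
independent random variables with density `m ^ m * x ^ (m - 1) * exp (-m * x) / Γ(m)` on `x ≥ 0`
(the gamma law of shape `m` and rate `m`), independent of the locations of the points. -/
structure IsNakagamiFading {Ω : Type*} [MeasurableSpace Ω] (μ : Measure Ω) (m : ℕ)
    (X : ℕ → Ω → Plane) (g : ℕ → Ω → ℝ) : Prop where
  measurable : ∀ j, Measurable (g j)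
  law : ∀ j, HasLaw (g j) (gammaMeasure (m : ℝ) (m : ℝ)) μ
  indep : iIndepFun g μ
  indep_points : IndepFun (fun ω j => X j ω) (fun ω j => g j ω) μ

/-- The distance from the user at the origin of the ground to a UAV at height `h` whose horizontal
distance is `r`. -/
noncomputable def slantDist (h r : ℝ) : ℝ := Real.sqrt (h ^ 2 + r ^ 2)

/-- The power received from the `j`-th UAV, counted only if its distance exceeds `rt`. -/
noncomputable def interferenceTerm {Ω : Type*} (X : ℕ → Ω → Plane) (g : ℕ → Ω → ℝ)
    (h P α rt : ℝ) (ω : Ω) (j : ℕ) : ℝ :=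
  open Classical in
  if rt < slantDist h ‖X j ω‖ then g j ω * P * slantDist h ‖X j ω‖ ^ (-α) else 0

/-- The aggregate interference from the UAVs at distance greater than `rt`. -/
noncomputable def interference {Ω : Type*} (X : ℕ → Ω → Plane) (g : ℕ → Ω → ℝ)
    (h P α rt : ℝ) (ω : Ω) : ℝ :=
  ∑' j, interferenceTerm X g h P α rt ω j

/-- The horizontal distance from the origin to the nearest UAV. -/
noncomputable def nearestHorizontalDist {Ω : Type*} (X : ℕ → Ω → Plane) (ω : Ω) : ℝ :=
  ⨅ j, ‖X j ω‖

/-- The incomplete Beta function `B(z; a, b) = ∫_0^z t ^ (a - 1) * (1 - t) ^ (b - 1) dt`, the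
integral being taken along the segment from `0` to `z` (`t = z * u`), with principal powers. -/
noncomputable def incompleteBeta (z a b : ℂ) : ℂ :=
  ∫ u in (0 : ℝ)..1, z * ((z * (u : ℂ)) ^ (a - 1) * (1 - z * (u : ℂ)) ^ (b - 1))

/-- The explicit expression for the Laplace transform of the interference, with `δ = 2 / α`:
`exp (-(2πλ/α) ∑_{i=1}^m (m choose i) (sP/m)^δ (-1)^(δ-i) B(-sP/(m rt^α); i - δ, 1 - m))`. -/
noncomputable def laplaceExpression (lam P α : ℝ) (m : ℕ) (s rt : ℝ) : ℂ :=
  Complex.exp (-(((2 * Real.pi * lam / α : ℝ) : ℂ) *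
    ∑ i ∈ Finset.Icc 1 m, (m.choose i : ℂ) * (((s * P / m) ^ (2 / α) : ℝ) : ℂ) *
      (-1 : ℂ) ^ (((2 / α - i : ℝ)) : ℂ) *
      incompleteBeta ((-(s * P) / (m * rt ^ α) : ℝ) : ℂ) ((i - 2 / α : ℝ) : ℂ) ((1 - m : ℝ) : ℂ)))

/-! Sums over the points are taken in `[0, ∞]` and fed to `expNeg`, so that no convergence has to be
known in advance. The starting point is the Laplace functional `E exp(-∑ f(X_j)) = exp(-λ ∫ (1 -
e^{-f}))`: independent Poisson counts give it for simple functions, and monotone limits for all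
measurable `f ≥ 0`. Since the gains are independent of the points and of each other, they can be
averaged out factor by factor; a received mean power `t` then contributes the gamma Laplace
transform `(1 + st/m)^{-m}` (`IsNakagamiFading.lintegral_expNeg_tsum`). Letting `s ↓ 0` shows that
the interference is almost surely finite, because the mean power is integrable over the plane for `α
> 2`.

For the closed form, polar coordinates and the substitution `u = (r_t/d)^α` reduce the exponent to
an integral over `(0, 1)`. Expanding `1 - (1 + t)^{-m}` by the binomial theorem splits it into
incomplete Beta integrals, and the powers of `-1` cancel the phases that come from the negative
argument.

For the conditional statement, let `R` be the nearest distance. Giving `f` the value `∞` on the ball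
of radius `a` encodes the event `R ≥ a`. For `a ≤ b` the functional then factors, so the
interference from beyond `b` has its unconditional transform on `R ≥ a`, and by subtraction on `a ≤
R < b`. Rounding `R` up to a grid, summing over cells and refining the grid by right continuity
yields the identity on every `R ≥ a`; these events determine a finite measure, hence the conditional
expectation. -/

open scoped ENNReal NNReal

/-! ### The exponential of a negative extended number -/

/-- The function `x ↦ exp (-x)` on `[0, ∞]`, with `exp (-∞) = 0`. -/
noncomputable def expNeg (x : ℝ≥0∞) : ℝ≥0∞ := EReal.exp (-(x : EReal))

theorem expNeg_zero : expNeg 0 = 1 := by simp [expNeg]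

theorem expNeg_top : expNeg ∞ = 0 := by simp [expNeg]

theorem continuous_expNeg : Continuous expNeg :=
  ENNReal.continuous_exp.comp (continuous_neg.comp continuous_coe_ennreal_ereal)

theorem measurable_expNeg : Measurable expNeg := continuous_expNeg.measurable

theorem antitone_expNeg : Antitone expNeg := fun _ _ hxy =>
  EReal.exp_monotone (EReal.neg_le_neg_iff.2 (EReal.coe_ennreal_le_coe_ennreal_iff.2 hxy))

theorem expNeg_le_one (x : ℝ≥0∞) : expNeg x ≤ 1 := by
  rw [← expNeg_zero]; exact antitone_expNeg (zero_le)

theorem expNeg_ne_top (x : ℝ≥0∞) : expNeg x ≠ ∞ :=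
  ne_top_of_le_ne_top ENNReal.one_ne_top (expNeg_le_one x)

theorem expNeg_add (x y : ℝ≥0∞) : expNeg (x + y) = expNeg x * expNeg y := by
  unfold expNeg
  rw [← EReal.exp_add, EReal.coe_ennreal_add, EReal.neg_add (by simp) (by simp), sub_eq_add_neg]

theorem expNeg_sum {ι : Type*} (s : Finset ι) (f : ι → ℝ≥0∞) :
    expNeg (∑ i ∈ s, f i) = ∏ i ∈ s, expNeg (f i) := by
  classical
  induction s using Finset.induction_on with
  | empty => simp [expNeg_zero]
  | insert a s ha ih => rw [Finset.sum_insert ha, Finset.prod_insert ha, expNeg_add, ih]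

theorem expNeg_ofReal {x : ℝ} (hx : 0 ≤ x) :
    expNeg (ENNReal.ofReal x) = ENNReal.ofReal (Real.exp (-x)) := by
  unfold expNeg
  rw [EReal.coe_ennreal_ofReal, max_eq_left hx, ← EReal.coe_neg, EReal.exp_coe]

theorem expNeg_mul_natCast (c : ℝ≥0∞) (n : ℕ) : expNeg (c * n) = expNeg c ^ n := by
  have := expNeg_sum (Finset.range n) (fun _ => c)
  simpa [mul_comm] using this

theorem expNeg_iSup {f : ℕ → ℝ≥0∞} (hf : Monotone f) : expNeg (⨆ n, f n) = ⨅ n, expNeg (f n) := by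
  refine tendsto_nhds_unique ((continuous_expNeg.tendsto _).comp (tendsto_atTop_iSup hf)) ?_
  exact tendsto_atTop_iInf (antitone_expNeg.comp_monotone hf)

/-- Any `[0, 1]`-valued function, zeros included, can therefore be written as `expNeg` of a `[0,
∞]`-valued one; this turns Laplace functionals into generating functionals. -/
theorem expNeg_toENNReal_neg_log {v : ℝ≥0∞} (hv : v ≤ 1) :
    expNeg ((-(ENNReal.log v)).toENNReal) = v := by
  have h0 : 0 ≤ -(ENNReal.log v) := by
    have : ENNReal.log v ≤ 0 := by
      rw [← EReal.exp_le_one_iff]; simpa using hv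
    simpa using EReal.neg_le_neg_iff.2 this
  rw [expNeg, EReal.coe_toENNReal h0, neg_neg, ENNReal.exp_log]

/-! ### Laplace functional of the Poisson process -/

/-- The probability generating function of the Poisson law. -/
theorem lintegral_expNeg_poissonMeasure (r : ℝ≥0) (c : ℝ≥0∞) :
    ∫⁻ n : ℕ, expNeg (c * n) ∂(poissonMeasure r) = expNeg (r * (1 - expNeg c)) := by
  obtain ⟨q, hq⟩ : ∃ q : ℝ≥0, expNeg c = q := ⟨(expNeg c).toNNReal, by
    rw [ENNReal.coe_toNNReal (expNeg_ne_top c)]⟩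
  have hq1 : (q : ℝ) ≤ 1 := by
    have := expNeg_le_one c
    rw [hq] at this
    exact_mod_cast this
  have hs : HasSum (fun n : ℕ => Real.exp (-r) * ((r * q : ℝ) ^ n / n.factorial))
      (Real.exp (-r) * Real.exp (r * q)) := by
    refine HasSum.mul_left _ ?_
    rw [Real.exp_eq_exp_ℝ]
    exact NormedSpace.expSeries_div_hasSum_exp (r * q : ℝ)
  rw [lintegral_countable']
  have : ∀ n : ℕ, expNeg (c * n) * poissonMeasure r {n} =
      ENNReal.ofReal (Real.exp (-r) * ((r * q : ℝ) ^ n / n.factorial)) := by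
    intro n
    rw [expNeg_mul_natCast, hq, poissonMeasure_singleton, ← ENNReal.ofReal_coe_nnreal,
      ← ENNReal.ofReal_pow (by positivity), ← ENNReal.ofReal_mul (by positivity)]
    congr 1
    rw [mul_pow]; ring
  simp_rw [this]
  rw [← ENNReal.ofReal_tsum_of_nonneg (fun n => by positivity) hs.summable, hs.tsum_eq, hq,
    ← ENNReal.ofReal_coe_nnreal (p := q), ← ENNReal.ofReal_one, ← ENNReal.ofReal_sub _ (by positivity),
    ← ENNReal.ofReal_coe_nnreal (p := r), ← ENNReal.ofReal_mul (by positivity),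
    expNeg_ofReal (mul_nonneg (by positivity) (by linarith)), ← Real.exp_add]
  congr 2; ring

theorem mul_toENNReal_pointCount {Ω : Type*} (X : ℕ → Ω → Plane) (A : Set Plane) (c : ℝ≥0∞) (ω : Ω) :
    c * (pointCount X A ω : ℝ≥0∞) = ∑' j, A.indicator (fun _ => c) (X j ω) := by
  rw [pointCount, ← ENNReal.tsum_set_one, tsum_subtype {j : ℕ | X j ω ∈ A} (fun _ => (1 : ℝ≥0∞)),
    ← ENNReal.tsum_mul_left]
  congr 1
  ext j
  by_cases h : X j ω ∈ A <;> simp [h]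

section

variable {Ω : Type*} [MeasurableSpace Ω] {μ : Measure Ω} {lam : ℝ} {X : ℕ → Ω → Plane}

theorem IsHomogeneousPoissonProcess.lintegral_expNeg_pointCount
    (hX : IsHomogeneousPoissonProcess μ lam X) (hlam : 0 ≤ lam) {A : Set Plane}
    (hA : MeasurableSet A) (hA' : volume A ≠ ∞) (c : ℝ≥0∞) :
    ∫⁻ ω, expNeg (c * (pointCount X A ω : ℝ≥0∞)) ∂μ =
      expNeg (ENNReal.ofReal lam * ((1 - expNeg c) * volume A)) := by
  have h := hX.count_law A hA hA'
  have hm : Measurable (fun n : ℕ∞ => expNeg (c * (n : ℝ≥0∞))) := measurable_from_top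
  rw [← lintegral_map' (f := fun n : ℕ∞ => expNeg (c * (n : ℝ≥0∞))) hm.aemeasurable h.aemeasurable,
    h.map_eq, lintegral_map hm measurable_from_top]
  simp only [ENat.toENNReal_coe]
  rw [lintegral_expNeg_poissonMeasure]
  congr 1
  rw [← ENNReal.ofReal, ENNReal.ofReal_mul hlam, measureReal_def, ENNReal.ofReal_toReal hA']
  ring

/-- The sum over points is a combination of the counts in the disjoint level sets. These counts are
independent, so the expectation is a product of Poisson generating functions, whose exponents add up
to the integral. -/
theorem IsHomogeneousPoissonProcess.lintegral_expNeg_tsum_simpleFunc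
    (hX : IsHomogeneousPoissonProcess μ lam X) (hlam : 0 ≤ lam) (f : SimpleFunc Plane ℝ≥0∞)
    (hf : ∀ c ≠ 0, volume (f ⁻¹' {c}) ≠ ∞) :
    ∫⁻ ω, expNeg (∑' j, f (X j ω)) ∂μ =
      expNeg (ENNReal.ofReal lam * ∫⁻ x, (1 - expNeg (f x))) := by
  classical
  -- The value `0` is dropped: it contributes nothing, and its level set may have infinite area.
  set S := f.range.filter (· ≠ 0) with hS
  let e := S.equivFin
  let c : Fin S.card → ℝ≥0∞ := fun k => (e.symm k : ℝ≥0∞)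
  let A : Fin S.card → Set Plane := fun k => f ⁻¹' {c k}
  have hc0 : ∀ k, c k ≠ 0 := fun k => (Finset.mem_filter.1 (e.symm k).2).2
  have hcinj : Function.Injective c := Subtype.val_injective.comp e.symm.injective
  have hA : ∀ k, MeasurableSet (A k) := fun k => f.measurableSet_fiber _
  have hA' : ∀ k, volume (A k) ≠ ∞ := fun k => hf _ (hc0 k)
  have hdisj : Pairwise (fun k l => Disjoint (A k) (A l)) := fun k l hkl =>
    Disjoint.preimage _ (Set.disjoint_singleton.2 (hcinj.ne hkl))
  have key : ∀ (G : ℝ≥0∞ → ℝ≥0∞), G 0 = 0 → ∀ x, G (f x) =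
      ∑ k, (A k).indicator (fun _ => G (c k)) x := by
    intro G hG x
    by_cases hx : f x = 0
    · rw [hx, hG, Finset.sum_eq_zero]
      intro k _
      refine Set.indicator_of_notMem (fun h => hc0 k ?_) _
      exact (Set.mem_singleton_iff.1 h).symm.trans hx
    · have hxS : f x ∈ S := Finset.mem_filter.2 ⟨SimpleFunc.mem_range_self f x, hx⟩
      have hcx : c (e ⟨f x, hxS⟩) = f x := by simp [c]
      rw [Finset.sum_eq_single (e ⟨f x, hxS⟩)]
      · rw [Set.indicator_of_mem, hcx]
        exact hcx.symm
      · intro k _ hk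
        refine Set.indicator_of_notMem (fun h => hk (hcinj ?_)) _
        exact (Set.mem_singleton_iff.1 h).symm.trans hcx.symm
      · simp
  have hsum : ∀ ω, ∑' j, f (X j ω) = ∑ k, c k * (pointCount X (A k) ω : ℝ≥0∞) := by
    intro ω
    simp_rw [mul_toENNReal_pointCount]
    rw [← Summable.tsum_finsetSum (fun _ _ => ENNReal.summable)]
    exact tsum_congr fun j => key id rfl (X j ω)
  simp_rw [hsum, expNeg_sum]
  have hind := (hX.count_indep S.card A hA hA' hdisj).comp
    (fun k (n : ℕ∞) => expNeg (c k * (n : ℝ≥0∞))) (fun k => measurable_from_top)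
  -- The law of a count only gives a.e. measurability; writing the count as a sum of indicators
  -- gives measurability.
  have hmeas : ∀ k, Measurable ((fun (n : ℕ∞) => expNeg (c k * (n : ℝ≥0∞))) ∘
      pointCount X (A k)) := by
    intro k
    have : ((fun (n : ℕ∞) => expNeg (c k * (n : ℝ≥0∞))) ∘ pointCount X (A k)) =
        fun ω => expNeg (∑' j, (A k).indicator (fun _ => c k) (X j ω)) := by
      ext ω; simp [← mul_toENNReal_pointCount]
    rw [this]
    refine measurable_expNeg.comp (Measurable.tsum fun j => ?_)
    exact (measurable_const.indicator (hA k)).comp (hX.measurable j)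
  have := lintegral_prod_eq_prod_lintegral_of_indepFun Finset.univ _ hind hmeas
  simp only [Function.comp_apply] at this
  rw [this]
  simp_rw [hX.lintegral_expNeg_pointCount hlam (hA _) (hA' _)]
  rw [← expNeg_sum, ← Finset.mul_sum]
  congr 2
  have h2 : ∀ x, 1 - expNeg (f x) = ∑ k, (A k).indicator (fun _ => 1 - expNeg (c k)) x :=
    key (fun t => 1 - expNeg t) (by simp [expNeg_zero])
  simp_rw [h2]
  rw [lintegral_finsetSum _ (fun k _ => measurable_const.indicator (hA k))]
  exact Finset.sum_congr rfl fun k _ => by rw [lintegral_indicator_const (hA k)]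

/-- The Laplace functional of a Poisson process. -/
theorem IsHomogeneousPoissonProcess.lintegral_expNeg_tsum [IsProbabilityMeasure μ]
    (hX : IsHomogeneousPoissonProcess μ lam X) (hlam : 0 ≤ lam) {f : Plane → ℝ≥0∞}
    (hf : Measurable f) :
    ∫⁻ ω, expNeg (∑' j, f (X j ω)) ∂μ =
      expNeg (ENNReal.ofReal lam * ∫⁻ x, (1 - expNeg (f x))) := by
  -- Restricting to growing balls makes the nonzero level sets of finite area and keeps the sequence
  -- increasing.
  let F : ℕ → SimpleFunc Plane ℝ≥0∞ := fun n =>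
    (SimpleFunc.eapprox f n).restrict (Metric.ball 0 n)
  have hFa : ∀ n x, F n x = (Metric.ball (0 : Plane) n).indicator (SimpleFunc.eapprox f n) x :=
    fun n x => SimpleFunc.restrict_apply _ Metric.isOpen_ball.measurableSet x
  have hmono : ∀ x, Monotone fun n => F n x := by
    intro x n k hnk
    simp only [hFa]
    refine (Set.indicator_le_indicator_of_subset (Metric.ball_subset_ball (by exact_mod_cast hnk))
      (fun _ => zero_le) x).trans (Set.indicator_le_indicator ?_)
    exact SimpleFunc.monotone_eapprox f hnk x
  have hsup : ∀ x, ⨆ n, F n x = f x := by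
    intro x
    refine le_antisymm (iSup_le fun n => ?_) ?_
    · rw [hFa, ← SimpleFunc.iSup_eapprox_apply hf x]
      exact (Set.indicator_le_self _ _ x).trans (le_iSup (fun n => SimpleFunc.eapprox f n x) n)
    · rw [← SimpleFunc.iSup_eapprox_apply hf x]
      obtain ⟨N, hN⟩ := exists_nat_gt ‖x‖
      refine iSup_le fun n => le_iSup_of_le (max n N) ?_
      rw [hFa, Set.indicator_of_mem]
      · exact SimpleFunc.monotone_eapprox f (le_max_left _ _) x
      · rw [mem_ball_zero_iff]
        exact hN.trans_le (by exact_mod_cast le_max_right _ _)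
  have hFfin : ∀ n, ∀ c ≠ 0, volume (F n ⁻¹' {c}) ≠ ∞ := by
    intro n c hc
    refine ne_top_of_le_ne_top (measure_ball_lt_top (x := (0 : Plane)) (r := n)).ne
      (measure_mono fun x hx => ?_)
    by_contra h
    refine hc ?_
    rw [← (Set.mem_singleton_iff.1 hx : F n x = c), hFa, Set.indicator_of_notMem h]
  have hsumsup : ∀ ω, ∑' j, f (X j ω) = ⨆ n, ∑' j, F n (X j ω) := by
    intro ω
    simp_rw [← hsup, ENNReal.tsum_eq_iSup_sum]
    rw [iSup_comm]
    congr 1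
    ext s
    rw [ENNReal.finsetSum_iSup_of_monotone (fun j => hmono _)]
  have hsummono : ∀ ω, Monotone fun n => ∑' j, F n (X j ω) := fun ω n k hnk =>
    ENNReal.tsum_le_tsum fun j => hmono _ hnk
  have hmono2 : Monotone fun n x => 1 - expNeg (F n x) := fun n k hnk x =>
    tsub_le_tsub_left (antitone_expNeg (hmono x hnk)) 1
  have hR : ∫⁻ x, (1 - expNeg (f x)) = ⨆ n, ∫⁻ x, (1 - expNeg (F n x)) := by
    have hm : ∀ n, Measurable fun x => 1 - expNeg (F n x) := fun n =>
      measurable_const.sub (measurable_expNeg.comp (F n).measurable)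
    rw [← lintegral_iSup hm hmono2]
    refine lintegral_congr fun x => ?_
    rw [← hsup, expNeg_iSup (hmono x), ENNReal.sub_iInf]
  simp_rw [hsumsup, expNeg_iSup (hsummono _)]
  rw [lintegral_iInf, hR, ENNReal.mul_iSup, expNeg_iSup]
  · simp_rw [hX.lintegral_expNeg_tsum_simpleFunc hlam (F _) (hFfin _)]
  · exact fun n k hnk => mul_le_mul_right (lintegral_mono (hmono2 hnk)) _
  · exact fun n => measurable_expNeg.comp (Measurable.tsum fun j =>
      (F n).measurable.comp (hX.measurable j))
  · exact fun n k hnk ω => antitone_expNeg (hsummono ω hnk)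
  · refine ne_top_of_le_ne_top (b := 1) ENNReal.one_ne_top ?_
    calc _ ≤ ∫⁻ ω, 1 ∂μ := lintegral_mono fun ω => expNeg_le_one _
      _ = 1 := by simp

/-- The probability generating functional of a Poisson process. -/
theorem IsHomogeneousPoissonProcess.lintegral_iInf_prod [IsProbabilityMeasure μ]
    (hX : IsHomogeneousPoissonProcess μ lam X) (hlam : 0 ≤ lam) {v : Plane → ℝ≥0∞}
    (hv : Measurable v) (hv1 : ∀ x, v x ≤ 1) :
    ∫⁻ ω, ⨅ n : ℕ, ∏ j ∈ Finset.range n, v (X j ω) ∂μ =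
      expNeg (ENNReal.ofReal lam * ∫⁻ x, (1 - v x)) := by
  let f : Plane → ℝ≥0∞ := fun x => (-(ENNReal.log (v x))).toENNReal
  have hf : Measurable f := (hv.ennreal_log.neg).ereal_toENNReal
  have hfv : ∀ x, expNeg (f x) = v x := fun x => expNeg_toENNReal_neg_log (hv1 x)
  have := hX.lintegral_expNeg_tsum hlam hf
  simp_rw [hfv] at this
  rw [← this]
  refine lintegral_congr fun ω => ?_
  rw [ENNReal.tsum_eq_iSup_nat, expNeg_iSup]
  · simp_rw [expNeg_sum, hfv]
  · exact fun n k hnk => Finset.sum_le_sum_of_subset (Finset.range_mono hnk)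

end

/-! ### Independent gamma marks -/

section

variable {Ω : Type*} [MeasurableSpace Ω] {μ : Measure Ω} {lam : ℝ} {X : ℕ → Ω → Plane}
  {m : ℕ} {g : ℕ → Ω → ℝ}

/-- By Fubini the points may be frozen, after which the factors depend on distinct independent
gains. Only finite products are treated; the infinite one is reached as a decreasing limit. -/
theorem IsNakagamiFading.lintegral_prod_eq [IsProbabilityMeasure μ]
    (hX : ∀ j, Measurable (X j)) (hg : IsNakagamiFading μ m X g) {κ : Plane × ℝ → ℝ≥0∞}
    (hκ : Measurable κ) (n : ℕ) :
    ∫⁻ ω, ∏ j ∈ Finset.range n, κ (X j ω, g j ω) ∂μ =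
      ∫⁻ ω, ∏ j ∈ Finset.range n, (∫⁻ y, κ (X j ω, y) ∂(gammaMeasure m m)) ∂μ := by
  have hXX : Measurable (fun ω j => X j ω) := measurable_pi_lambda _ hX
  have hGG : Measurable (fun ω j => g j ω) := measurable_pi_lambda _ hg.measurable
  have hmap := (indepFun_iff_map_prod_eq_prod_map_map hXX.aemeasurable hGG.aemeasurable).1
    hg.indep_points
  let K : (ℕ → Plane) × (ℕ → ℝ) → ℝ≥0∞ := fun p => ∏ j ∈ Finset.range n, κ (p.1 j, p.2 j)
  have hK : Measurable K := by
    refine Finset.measurable_fun_prod _ fun j _ => hκ.comp ?_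
    fun_prop
  have : IsProbabilityMeasure (μ.map (fun ω j => g j ω)) :=
    Measure.isProbabilityMeasure_map hGG.aemeasurable
  have h1 : ∫⁻ ω, ∏ j ∈ Finset.range n, κ (X j ω, g j ω) ∂μ =
      ∫⁻ p, K p ∂(μ.map (fun ω => ((fun j => X j ω), (fun j => g j ω)))) := by
    rw [lintegral_map hK (hXX.prodMk hGG)]
  rw [h1, hmap, lintegral_prod _ hK.aemeasurable, lintegral_map hK.lintegral_prod_right' hXX]
  refine lintegral_congr fun ω => ?_
  have hKω : Measurable fun y => K (fun j => X j ω, y) := hK.comp measurable_prodMk_left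
  rw [lintegral_map hKω hGG]
  have hκ' : ∀ x, Measurable fun y => κ (x, y) := fun x =>
    hκ.comp (measurable_const.prodMk measurable_id)
  have hind := hg.indep.comp (fun j y => κ (X j ω, y)) (fun j => hκ' _)
  have := lintegral_prod_eq_prod_lintegral_of_indepFun (Finset.range n) _ hind
    (fun j => (hκ' _).comp (hg.measurable j))
  simp only [Function.comp_apply] at this
  simp only [K]
  rw [this]
  refine Finset.prod_congr rfl fun j _ => ?_
  rw [← (hg.law j).map_eq, lintegral_map (hκ' _) (hg.measurable j)]

theorem isProbabilityMeasure_gammaMeasure_natCast (hm : 1 ≤ m) :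
    IsProbabilityMeasure (gammaMeasure (m : ℝ) m) :=
  isProbabilityMeasure_gammaMeasure (by positivity) (by positivity)

/-- The Laplace functional of a Poisson process with independent gamma marks. -/
theorem IsNakagamiFading.lintegral_expNeg_tsum [IsProbabilityMeasure μ]
    (hX : IsHomogeneousPoissonProcess μ lam X) (hg : IsNakagamiFading μ m X g)
    (hlam : 0 ≤ lam) (hm : 1 ≤ m) {F : Plane × ℝ → ℝ≥0∞} (hF : Measurable F) :
    ∫⁻ ω, expNeg (∑' j, F (X j ω, g j ω)) ∂μ =
      expNeg (ENNReal.ofReal lam *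
        ∫⁻ x, (1 - ∫⁻ y, expNeg (F (x, y)) ∂(gammaMeasure m m))) := by
  have := isProbabilityMeasure_gammaMeasure_natCast hm
  have hκ : Measurable fun p => expNeg (F p) := measurable_expNeg.comp hF
  let v : Plane → ℝ≥0∞ := fun x => ∫⁻ y, expNeg (F (x, y)) ∂(gammaMeasure m m)
  have hv : Measurable v := hκ.lintegral_prod_right'
  have hv1 : ∀ x, v x ≤ 1 := fun x => by
    calc v x ≤ ∫⁻ _, 1 ∂(gammaMeasure (m : ℝ) m) := lintegral_mono fun y => expNeg_le_one _
      _ = 1 := by simp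
  -- `v x` is the factor of a point at `x` averaged over its gain, so the target is the generating
  -- functional at `v`.
  rw [← hX.lintegral_iInf_prod hlam hv hv1]
  have hanti : ∀ u : ℕ → ℝ≥0∞, (∀ j, u j ≤ 1) →
      Antitone fun n : ℕ => ∏ j ∈ Finset.range n, u j := fun u hu =>
    antitone_nat_of_succ_le fun n => by
      rw [Finset.prod_range_succ]; exact mul_le_of_le_one_right' (hu n)
  have hmX : ∀ j, Measurable fun ω => (X j ω, g j ω) := fun j =>
    (hX.measurable j).prodMk (hg.measurable j)
  have h1 : ∀ ω, expNeg (∑' j, F (X j ω, g j ω)) =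
      ⨅ n : ℕ, ∏ j ∈ Finset.range n, expNeg (F (X j ω, g j ω)) := by
    intro ω
    rw [ENNReal.tsum_eq_iSup_nat, expNeg_iSup]
    · simp_rw [expNeg_sum]
    · exact fun n k hnk => Finset.sum_le_sum_of_subset (Finset.range_mono hnk)
  simp_rw [h1]
  rw [lintegral_iInf, lintegral_iInf]
  · exact iInf_congr fun n => hg.lintegral_prod_eq hX.measurable hκ n
  · exact fun n => Finset.measurable_fun_prod _ fun j _ => hv.comp (hX.measurable j)
  · exact fun n k hnk ω => hanti _ (fun j => hv1 _) hnk
  · simp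
  · exact fun n => Finset.measurable_fun_prod _ fun j _ => hκ.comp (hmX j)
  · exact fun n k hnk ω => hanti _ (fun j => expNeg_le_one _) hnk
  · simp

theorem ae_nonneg_gammaMeasure (a r : ℝ) : ∀ᵐ y ∂(gammaMeasure a r), 0 ≤ y := by
  have : {y : ℝ | ¬ 0 ≤ y} = Set.Iio 0 := by ext; simp
  rw [ae_iff, this, gammaMeasure, withDensity_apply _ measurableSet_Iio,
    lintegral_gammaPDF_of_nonpos le_rfl]

theorem IsNakagamiFading.ae_nonneg (hg : IsNakagamiFading μ m X g) : ∀ᵐ ω ∂μ, ∀ j, 0 ≤ g j ω := by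
  rw [ae_all_iff]
  intro j
  have := ae_nonneg_gammaMeasure m m
  rw [← (hg.law j).map_eq] at this
  exact ae_of_ae_map (hg.measurable j).aemeasurable this

/-- The Laplace transform of the gamma law of shape and rate `m`. -/
theorem lintegral_expNeg_gammaMeasure (hm : 1 ≤ m) {t : ℝ} (ht : 0 ≤ t) :
    ∫⁻ y, expNeg (ENNReal.ofReal (t * y)) ∂(gammaMeasure m m) =
      ENNReal.ofReal (((1 + t / m) ^ m)⁻¹) := by
  have hm0 : (0 : ℝ) < m := by positivity
  have hmeas : Measurable fun y : ℝ => expNeg (ENNReal.ofReal (t * y)) :=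
    measurable_expNeg.comp (by fun_prop)
  have hpdf : ∀ r : ℝ, Measurable (gammaPDF m r) := fun r =>
    (measurable_gammaPDFReal _ _).ennreal_ofReal
  rw [gammaMeasure, lintegral_withDensity_eq_lintegral_mul _ (hpdf _) hmeas]
  -- Exponential tilting: `e^{-ty}` turns the gamma density of rate `m` into a multiple of the one
  -- of rate `m + t`.
  have : ∀ y : ℝ, (gammaPDF m m * fun y : ℝ => expNeg (ENNReal.ofReal (t * y))) y =
      ENNReal.ofReal (((1 + t / m) ^ m)⁻¹) * gammaPDF m (m + t) y := by
    intro y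
    simp only [Pi.mul_apply]
    rcases lt_or_ge y 0 with hy | hy
    · simp [gammaPDF_of_neg hy]
    · rw [gammaPDF_of_nonneg hy, gammaPDF_of_nonneg hy, expNeg_ofReal (by positivity),
        ← ENNReal.ofReal_mul' (by positivity), ← ENNReal.ofReal_mul (by positivity)]
      congr 1
      rw [Real.rpow_natCast, Real.rpow_natCast]
      have : (m + t : ℝ) ^ m = (m : ℝ) ^ m * (1 + t / m) ^ m := by
        rw [← mul_pow]; congr 1; field_simp
      rw [this, show -((m + t) * y) = -(m * y) + -(t * y) by ring, Real.exp_add]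
      field_simp
  simp_rw [this]
  rw [lintegral_const_mul _ (hpdf _), lintegral_gammaPDF_eq_one hm0 (by positivity), mul_one]

/-- Bernoulli's inequality for `(1 + t/m)⁻¹ = 1 + a` with `a ≥ -t/m`. It dominates the integrand of
the exponent by the mean power. -/
theorem one_sub_inv_pow_le {t : ℝ} (ht : 0 ≤ t) (hm : 1 ≤ m) :
    1 - ((1 + t / m) ^ m)⁻¹ ≤ t := by
  have hm0 : (0 : ℝ) < m := by positivity
  have h1 : -(t / m) ≤ (1 + t / m)⁻¹ - 1 := by
    rw [neg_le_sub_iff_le_add, inv_eq_one_div, div_add' _ _ _ (by positivity),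
      le_div_iff₀ (by positivity)]
    nlinarith [sq_nonneg (t / m)]
  have h2 := one_add_mul_le_pow (a := (1 + t / m)⁻¹ - 1)
    (by have : 0 ≤ (1 + t / m)⁻¹ := by positivity
        linarith) m
  rw [add_sub_cancel, inv_pow] at h2
  have h3 := mul_le_mul_of_nonneg_left h1 hm0.le
  have : (m : ℝ) * -(t / m) = -t := by field_simp
  linarith

end

/-! ### Mean power as a function of the horizontal position -/

/-- The mean power received from a UAV at horizontal position `x`, counted only if the horizontal
distance exceeds `r`. -/
noncomputable def farGain (h P α r : ℝ) (x : Plane) : ℝ :=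
  (Metric.closedBall (0 : Plane) r)ᶜ.indicator (fun x => P * slantDist h ‖x‖ ^ (-α)) x

/-- The Laplace transform of the interference from beyond the horizontal distance `r`. -/
noncomputable def farLaplace (lam h P α : ℝ) (m : ℕ) (s r : ℝ) : ℝ≥0∞ :=
  expNeg (ENNReal.ofReal lam *
    ∫⁻ x, (1 - ENNReal.ofReal (((1 + s * farGain h P α r x / m) ^ m)⁻¹)))

theorem slantDist_pos {h : ℝ} (hh : 0 < h) (r : ℝ) : 0 < slantDist h r :=
  Real.sqrt_pos.2 (by positivity)

theorem slantDist_lt_slantDist_iff {h r t : ℝ} (hr : 0 ≤ r) (ht : 0 ≤ t) :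
    slantDist h r < slantDist h t ↔ r < t := by
  rw [slantDist, slantDist, Real.sqrt_lt_sqrt_iff (by positivity), add_lt_add_iff_left,
    sq_lt_sq₀ hr ht]

theorem farGain_of_lt {h P α r : ℝ} {x : Plane} (hx : r < ‖x‖) :
    farGain h P α r x = P * slantDist h ‖x‖ ^ (-α) :=
  Set.indicator_of_mem (by simpa using hx) _

theorem farGain_of_le {h P α r : ℝ} {x : Plane} (hx : ‖x‖ ≤ r) : farGain h P α r x = 0 :=
  Set.indicator_of_notMem (by simpa using hx) _

theorem farGain_nonneg {h P α r : ℝ} (hP : 0 ≤ P) (x : Plane) : 0 ≤ farGain h P α r x :=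
  Set.indicator_nonneg (fun _ _ => mul_nonneg hP (Real.rpow_nonneg (Real.sqrt_nonneg _) _)) x

theorem farGain_antitone {h P α : ℝ} (hP : 0 ≤ P) (x : Plane) :
    Antitone fun r => farGain h P α r x := by
  intro r t hrt
  rcases le_or_gt ‖x‖ t with hx | hx
  · simpa only [farGain_of_le hx] using farGain_nonneg hP x
  · simp only [farGain_of_lt hx, farGain_of_lt (hrt.trans_lt hx), le_refl]

theorem measurable_slantDist (h : ℝ) : Measurable (slantDist h) := by
  unfold slantDist; fun_prop

theorem measurable_farGain (h P α r : ℝ) : Measurable (farGain h P α r) := by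
  refine Measurable.indicator ?_ Metric.isClosed_closedBall.measurableSet.compl
  have := (measurable_slantDist h).comp (measurable_norm (α := Plane))
  exact measurable_const.mul (this.pow_const (-α))

/-- The height removes the singularity at the origin: `h² + ‖x‖² ≥ min(1, h²) (1 + ‖x‖²)`. At
infinity, `α` exceeds the dimension `2`. -/
theorem integrable_farGain {h P α : ℝ} (hh : 0 < h) (hP : 0 ≤ P) (hα : 2 < α) (r : ℝ) :
    Integrable (farGain h P α r) := by
  have h1 : Integrable (fun x : Plane => (1 + ‖x‖ ^ 2) ^ (-α / 2)) :=
    integrable_rpow_neg_one_add_norm_sq (by simpa using hα)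
  set c : ℝ := min 1 (h ^ 2)
  have hc : 0 < c := lt_min one_pos (by positivity)
  refine (h1.const_mul (P * c ^ (-α / 2))).mono' (measurable_farGain _ _ _ _).aestronglyMeasurable
    (Filter.Eventually.of_forall fun x => ?_)
  rw [Real.norm_of_nonneg (farGain_nonneg hP x)]
  have h2 : P * slantDist h ‖x‖ ^ (-α) ≤ P * c ^ (-α / 2) * (1 + ‖x‖ ^ 2) ^ (-α / 2) := by
    rw [mul_assoc, ← Real.mul_rpow hc.le (by positivity), slantDist, Real.sqrt_eq_rpow,
      ← Real.rpow_mul (by positivity), show 1 / 2 * -α = -α / 2 by ring]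
    refine mul_le_mul_of_nonneg_left ?_ hP
    refine Real.rpow_le_rpow_of_nonpos (by positivity) ?_ (by linarith)
    nlinarith [min_le_left 1 (h ^ 2), min_le_right 1 (h ^ 2), sq_nonneg ‖x‖]
  rcases le_or_gt ‖x‖ r with hx | hx
  · rw [farGain_of_le hx]
    positivity
  · rwa [farGain_of_lt hx]

/-! ### Convergence of the interference, and its law given the absence of near points -/

section

variable {Ω : Type*} [MeasurableSpace Ω] {μ : Measure Ω} {lam : ℝ} {X : ℕ → Ω → Plane}
  {m : ℕ} {g : ℕ → Ω → ℝ} {h P α : ℝ}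

theorem interferenceTerm_slantDist {Ω : Type*} {X : ℕ → Ω → Plane} {g : ℕ → Ω → ℝ} {h P α r : ℝ}
    (hr : 0 ≤ r) (ω : Ω) (j : ℕ) :
    interferenceTerm X g h P α (slantDist h r) ω j = farGain h P α r (X j ω) * g j ω := by
  unfold interferenceTerm
  split_ifs with hx <;> rw [slantDist_lt_slantDist_iff hr (norm_nonneg _)] at hx
  · rw [farGain_of_lt hx]; ring
  · rw [farGain_of_le (not_lt.1 hx), zero_mul]

theorem lintegral_one_sub_le (hP : 0 ≤ P) (hm : 1 ≤ m) {s : ℝ} (hs : 0 ≤ s) (r : ℝ) :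
    ∫⁻ x, (1 - ENNReal.ofReal (((1 + s * farGain h P α r x / m) ^ m)⁻¹)) ≤
      ENNReal.ofReal s * ∫⁻ x, ENNReal.ofReal (farGain h P α r x) := by
  rw [← lintegral_const_mul _ (measurable_farGain h P α r).ennreal_ofReal]
  refine lintegral_mono fun x => ?_
  have h0 := farGain_nonneg (h := h) (α := α) (r := r) hP x
  rw [← ENNReal.ofReal_one, ← ENNReal.ofReal_sub _ (by positivity), ← ENNReal.ofReal_mul hs]
  exact ENNReal.ofReal_le_ofReal (one_sub_inv_pow_le (by positivity) hm)

/-- For the sum `T` and `s > 0`, `P(T < ∞) ≥ E e^{-sT} ≥ exp(-λ s J)`, where `J` is the integral of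
the mean power. As `J` is finite, the right side tends to `1` when `s ↓ 0`. -/
theorem ae_tsum_farGain_ne_top [IsProbabilityMeasure μ]
    (hX : IsHomogeneousPoissonProcess μ lam X) (hg : IsNakagamiFading μ m X g)
    (hlam : 0 ≤ lam) (hm : 1 ≤ m) (hh : 0 < h) (hP : 0 ≤ P) (hα : 2 < α) (r : ℝ) :
    ∀ᵐ ω ∂μ, ∑' j, ENNReal.ofReal (farGain h P α r (X j ω) * g j ω) ≠ ∞ := by
  let F : Plane × ℝ → ℝ≥0∞ := fun p => ENNReal.ofReal (farGain h P α r p.1 * p.2)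
  have hF : Measurable F :=
    (((measurable_farGain h P α r).comp measurable_fst).mul measurable_snd).ennreal_ofReal
  let T : Ω → ℝ≥0∞ := fun ω => ∑' j, F (X j ω, g j ω)
  have hT : Measurable T := Measurable.tsum fun j =>
    hF.comp ((hX.measurable j).prodMk (hg.measurable j))
  have hTs : MeasurableSet {ω | T ω ≠ ∞} := (hT (measurableSet_singleton ∞)).compl
  set J := ∫⁻ x, ENNReal.ofReal (farGain h P α r x)
  have hJ : J ≠ ∞ := (integrable_farGain hh hP hα r).lintegral_lt_top.ne
  have key : ∀ n : ℕ, expNeg (ENNReal.ofReal lam * (ENNReal.ofReal (1 / ((n : ℝ) + 1)) * J)) ≤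
      μ {ω | T ω ≠ ∞} := by
    intro n
    set s : ℝ := 1 / ((n : ℝ) + 1)
    have hs : 0 < s := by positivity
    have h1 := hg.lintegral_expNeg_tsum hX hlam hm (hF.const_mul (ENNReal.ofReal s))
    have h2 : ∀ x, ∫⁻ y, expNeg (ENNReal.ofReal s * F (x, y)) ∂(gammaMeasure (m : ℝ) m) =
        ENNReal.ofReal (((1 + s * farGain h P α r x / m) ^ m)⁻¹) := by
      intro x
      rw [← lintegral_expNeg_gammaMeasure hm (mul_nonneg hs.le (farGain_nonneg hP x))]
      simp only [F]
      simp_rw [← ENNReal.ofReal_mul hs.le, mul_assoc]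
    simp_rw [h2] at h1
    calc _ ≤ ∫⁻ ω, expNeg (∑' j, ENNReal.ofReal s * F (X j ω, g j ω)) ∂μ := by
          rw [h1]
          exact antitone_expNeg (mul_le_mul_right (lintegral_one_sub_le hP hm hs.le r) _)
      _ ≤ ∫⁻ ω, {ω | T ω ≠ ∞}.indicator 1 ω ∂μ := by
          refine lintegral_mono fun ω => ?_
          dsimp only
          rw [ENNReal.tsum_mul_left]
          by_cases hω : T ω = ∞
          · have : ∑' j, F (X j ω, g j ω) = ∞ := hω
            rw [this, ENNReal.mul_top (by simpa using hs), expNeg_top]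
            exact zero_le
          · rw [Set.indicator_of_mem hω]
            exact expNeg_le_one _
      _ = _ := lintegral_indicator_one hTs
  have hlim : Filter.Tendsto
      (fun n : ℕ => expNeg (ENNReal.ofReal lam * (ENNReal.ofReal (1 / ((n : ℝ) + 1)) * J)))
      Filter.atTop (nhds 1) := by
    rw [← expNeg_zero]
    refine (continuous_expNeg.tendsto 0).comp ?_
    have h0 : Filter.Tendsto (fun n : ℕ => ENNReal.ofReal (1 / ((n : ℝ) + 1))) Filter.atTop
        (nhds 0) := by
      rw [← ENNReal.ofReal_zero]
      exact ENNReal.tendsto_ofReal tendsto_one_div_add_atTop_nhds_zero_nat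
    have h1 := ENNReal.Tendsto.mul_const (b := J) h0 (Or.inr hJ)
    have h2 := ENNReal.Tendsto.const_mul (a := ENNReal.ofReal lam) h1 (Or.inr (by simp))
    simpa using h2
  have h1 : μ {ω | T ω ≠ ∞} = 1 := le_antisymm prob_le_one (le_of_tendsto' hlim key)
  have h2 := (prob_compl_eq_zero_iff hTs).2 h1
  exact h2

/-- Almost surely, the interference from beyond any distance is a convergent series of nonnegative
terms. -/
theorem ae_summable_farGain [IsProbabilityMeasure μ]
    (hX : IsHomogeneousPoissonProcess μ lam X) (hg : IsNakagamiFading μ m X g)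
    (hlam : 0 ≤ lam) (hm : 1 ≤ m) (hh : 0 < h) (hP : 0 ≤ P) (hα : 2 < α) :
    ∀ᵐ ω ∂μ, (∀ j, 0 ≤ g j ω) ∧
      ∀ r, -1 ≤ r → Summable fun j => farGain h P α r (X j ω) * g j ω := by
  -- The ball of radius `-1` is empty, so this one series counts every point and dominates those for
  -- all `r ≥ -1` off a single null set.
  filter_upwards [hg.ae_nonneg, ae_tsum_farGain_ne_top hX hg hlam hm hh hP hα (-1)] with ω h0 h1
  refine ⟨h0, fun r hr => ?_⟩
  have h2 := ENNReal.summable_toReal h1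
  refine Summable.of_nonneg_of_le (fun j => mul_nonneg (farGain_nonneg hP _) (h0 j))
    (fun j => ?_) h2
  rw [ENNReal.toReal_ofReal (mul_nonneg (farGain_nonneg hP _) (h0 j))]
  exact mul_le_mul_of_nonneg_right (farGain_antitone hP _ hr) (h0 j)

theorem ofReal_exp_neg_tsum {u : ℕ → ℝ} (hu : ∀ j, 0 ≤ u j) (hs : Summable u) :
    ENNReal.ofReal (Real.exp (-∑' j, u j)) = expNeg (∑' j, ENNReal.ofReal (u j)) := by
  rw [← ENNReal.ofReal_tsum_of_nonneg hu hs, expNeg_ofReal (tsum_nonneg hu)]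

theorem le_nearestHorizontalDist_iff {Ω : Type*} {X : ℕ → Ω → Plane} {a : ℝ} {ω : Ω} :
    a ≤ nearestHorizontalDist X ω ↔ ∀ j, a ≤ ‖X j ω‖ :=
  le_ciInf_iff ⟨0, by rintro _ ⟨j, rfl⟩; exact norm_nonneg _⟩

theorem nearestHorizontalDist_nonneg {Ω : Type*} (X : ℕ → Ω → Plane) (ω : Ω) :
    0 ≤ nearestHorizontalDist X ω := le_nearestHorizontalDist_iff.2 fun _ => norm_nonneg _

theorem measurable_nearestHorizontalDist (hX : ∀ j, Measurable (X j)) :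
    Measurable (nearestHorizontalDist X) :=
  Measurable.iInf fun j => (hX j).norm

/-- The Laplace transform of the interference from beyond `b`, on the event that there are no UAVs
closer than `a`. -/
theorem setLIntegral_exp_neg_interference_eq_expNeg_mul [IsProbabilityMeasure μ]
    (hX : IsHomogeneousPoissonProcess μ lam X) (hg : IsNakagamiFading μ m X g)
    (hlam : 0 ≤ lam) (hm : 1 ≤ m) (hh : 0 < h) (hP : 0 ≤ P) (hα : 2 < α) {a b s : ℝ}
    (hab : a ≤ b) (hb : 0 ≤ b) (hs : 0 ≤ s) :
    ∫⁻ ω in {ω | a ≤ nearestHorizontalDist X ω},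
        ENNReal.ofReal (Real.exp (-(s * interference X g h P α (slantDist h b) ω))) ∂μ =
      expNeg (ENNReal.ofReal lam * volume (Metric.ball (0 : Plane) a)) *
        farLaplace lam h P α m s b := by
  let B := Metric.ball (0 : Plane) a
  have hB : MeasurableSet B := Metric.isOpen_ball.measurableSet
  -- One point in the ball makes the sum infinite and its `expNeg` zero, so the first term acts as
  -- the indicator of the event.
  let F : Plane × ℝ → ℝ≥0∞ := fun p =>
    B.indicator (fun _ => ∞) p.1 + ENNReal.ofReal (s * farGain h P α b p.1 * p.2)
  have hF : Measurable F := by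
    refine ((measurable_const.indicator hB).comp measurable_fst).add ?_
    exact ((((measurable_farGain h P α b).comp measurable_fst).const_mul s).mul
      measurable_snd).ennreal_ofReal
  have h1 := hg.lintegral_expNeg_tsum hX hlam hm hF
  -- Since `a ≤ b`, the far gain vanishes on the ball, and the two contributions have disjoint
  -- supports.
  have h2 : ∀ x, 1 - ∫⁻ y, expNeg (F (x, y)) ∂(gammaMeasure (m : ℝ) m) =
      B.indicator 1 x + (1 - ENNReal.ofReal (((1 + s * farGain h P α b x / m) ^ m)⁻¹)) := by
    intro x
    simp only [F]
    by_cases hx : x ∈ B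
    · have hx' : ‖x‖ ≤ b := (mem_ball_zero_iff.1 hx).le.trans hab
      simp [hx, farGain_of_le hx', expNeg_top]
    · simp only [Set.indicator_of_notMem hx, zero_add]
      rw [lintegral_expNeg_gammaMeasure hm (mul_nonneg hs (farGain_nonneg hP x))]
  simp_rw [h2] at h1
  rw [lintegral_add_left (measurable_one.indicator hB), lintegral_indicator_one hB, mul_add,
    expNeg_add] at h1
  rw [farLaplace, ← h1, ← lintegral_indicator
    (measurableSet_le measurable_const (measurable_nearestHorizontalDist hX.measurable))]
  refine lintegral_congr_ae ?_
  filter_upwards [ae_summable_farGain hX hg hlam hm hh hP hα] with ω hω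
  by_cases hR : a ≤ nearestHorizontalDist X ω
  · rw [Set.indicator_of_mem (by exact hR), interference, ← tsum_mul_left]
    have hR' : ∀ j, X j ω ∉ B := fun j => by
      simpa [B] using le_nearestHorizontalDist_iff.1 hR j
    simp only [F, Set.indicator_of_notMem (hR' _), zero_add, mul_assoc,
      interferenceTerm_slantDist hb]
    rw [ofReal_exp_neg_tsum]
    · exact fun j => mul_nonneg hs (mul_nonneg (farGain_nonneg hP _) (hω.1 j))
    · exact (hω.2 b (by linarith)).mul_left s
  · rw [Set.indicator_of_notMem (by exact hR)]
    rw [le_nearestHorizontalDist_iff] at hR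
    push Not at hR
    obtain ⟨j, hj⟩ := hR
    have : ∑' j, F (X j ω, g j ω) = ∞ := by
      refine ENNReal.tsum_eq_top_of_eq_top ⟨j, ?_⟩
      have : X j ω ∈ B := by simpa [B] using hj
      simp [F, this]
    rw [this, expNeg_top]

theorem farLaplace_zero (b : ℝ) : farLaplace lam h P α m 0 b = 1 := by
  simp [farLaplace, expNeg_zero]

theorem lintegral_exp_neg_interference [IsProbabilityMeasure μ]
    (hX : IsHomogeneousPoissonProcess μ lam X) (hg : IsNakagamiFading μ m X g)
    (hlam : 0 ≤ lam) (hm : 1 ≤ m) (hh : 0 < h) (hP : 0 ≤ P) (hα : 2 < α) {b s : ℝ}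
    (hb : 0 ≤ b) (hs : 0 ≤ s) :
    ∫⁻ ω, ENNReal.ofReal (Real.exp (-(s * interference X g h P α (slantDist h b) ω))) ∂μ =
      farLaplace lam h P α m s b := by
  have := setLIntegral_exp_neg_interference_eq_expNeg_mul hX hg hlam hm hh hP hα hb hb hs
  simpa [nearestHorizontalDist_nonneg, expNeg_zero] using this

/-- Taking `s = 0` in the factorised formula identifies its first factor as the probability that the
ball is empty. -/
theorem setLIntegral_exp_neg_interference [IsProbabilityMeasure μ]
    (hX : IsHomogeneousPoissonProcess μ lam X) (hg : IsNakagamiFading μ m X g)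
    (hlam : 0 ≤ lam) (hm : 1 ≤ m) (hh : 0 < h) (hP : 0 ≤ P) (hα : 2 < α) {a b s : ℝ}
    (hab : a ≤ b) (hb : 0 ≤ b) (hs : 0 ≤ s) :
    ∫⁻ ω in {ω | a ≤ nearestHorizontalDist X ω},
        ENNReal.ofReal (Real.exp (-(s * interference X g h P α (slantDist h b) ω))) ∂μ =
      farLaplace lam h P α m s b * μ {ω | a ≤ nearestHorizontalDist X ω} := by
  have h0 := setLIntegral_exp_neg_interference_eq_expNeg_mul hX hg hlam hm hh hP hα hab hb le_rfl
  rw [farLaplace_zero, mul_one] at h0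
  simp only [zero_mul, neg_zero, Real.exp_zero, ENNReal.ofReal_one, setLIntegral_one] at h0
  rw [setLIntegral_exp_neg_interference_eq_expNeg_mul hX hg hlam hm hh hP hα hab hb hs, h0,
    mul_comm]

/-- On the event that the nearest UAV is at a distance in `[a, b)`, the interference from beyond `b`
has its unconditional law. -/
theorem setLIntegral_exp_neg_interference_Ico [IsProbabilityMeasure μ]
    (hX : IsHomogeneousPoissonProcess μ lam X) (hg : IsNakagamiFading μ m X g)
    (hlam : 0 ≤ lam) (hm : 1 ≤ m) (hh : 0 < h) (hP : 0 ≤ P) (hα : 2 < α) {a b s : ℝ}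
    (hab : a ≤ b) (hb : 0 ≤ b) (hs : 0 ≤ s) :
    ∫⁻ ω in nearestHorizontalDist X ⁻¹' Set.Ico a b,
        ENNReal.ofReal (Real.exp (-(s * interference X g h P α (slantDist h b) ω))) ∂μ =
      farLaplace lam h P α m s b * μ (nearestHorizontalDist X ⁻¹' Set.Ico a b) := by
  have hR := measurable_nearestHorizontalDist hX.measurable
  have hU : {ω | a ≤ nearestHorizontalDist X ω} =
      nearestHorizontalDist X ⁻¹' Set.Ico a b ∪ {ω | b ≤ nearestHorizontalDist X ω} := by
    ext ω
    simp only [Set.mem_ofPred_eq, Set.mem_union, Set.mem_preimage, Set.mem_Ico]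
    constructor
    · intro h1
      rcases lt_or_ge (nearestHorizontalDist X ω) b with h2 | h2
      · exact Or.inl ⟨h1, h2⟩
      · exact Or.inr h2
    · rintro (h1 | h1)
      · exact h1.1
      · exact hab.trans h1
  have hD : Disjoint (nearestHorizontalDist X ⁻¹' Set.Ico a b)
      {ω | b ≤ nearestHorizontalDist X ω} :=
    Set.disjoint_left.2 fun ω h1 h2 => absurd h1.2 (not_lt.2 h2)
  have hM : MeasurableSet {ω | b ≤ nearestHorizontalDist X ω} :=
    measurableSet_le measurable_const hR
  have ha := setLIntegral_exp_neg_interference hX hg hlam hm hh hP hα hab hb hs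
  have hbb := setLIntegral_exp_neg_interference hX hg hlam hm hh hP hα le_rfl hb hs
  rw [hU, lintegral_union hM hD, measure_union hD hM, mul_add, hbb] at ha
  refine (ENNReal.add_left_inj ?_).1 ha
  exact ENNReal.mul_ne_top (expNeg_ne_top _) (measure_ne_top _ _)

end

/-! ### Closed form of the Laplace transform -/

/-- On the segment, `(-Yu)^{a-1}` has phase `e^{iπ(a-1)}` and `(-1)^{-a}` is `e^{-iπa}`. Their
product is `-1`, which cancels the sign of the factor `z = -Y`. -/
theorem neg_one_cpow_mul_incompleteBeta {Y : ℝ} (hY : 0 < Y) (a : ℝ) (m : ℕ) :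
    (-1 : ℂ) ^ (((-a : ℝ)) : ℂ) * incompleteBeta ((-Y : ℝ) : ℂ) (a : ℂ) ((1 - m : ℝ) : ℂ) =
      ((∫ u in (0 : ℝ)..1, Y * ((Y * u) ^ (a - 1) * ((1 + Y * u) ^ m)⁻¹) : ℝ) : ℂ) := by
  rw [incompleteBeta, ← intervalIntegral.integral_const_mul, ← intervalIntegral.integral_ofReal]
  refine intervalIntegral.integral_congr_ae (Filter.Eventually.of_forall fun u hu => ?_)
  rw [Set.uIoc_of_le zero_le_one] at hu
  have hYu : 0 < Y * u := mul_pos hY hu.1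
  have h1 : (1 : ℂ) - ((-Y : ℝ) : ℂ) * (u : ℂ) = ((1 + Y * u : ℝ) : ℂ) := by push_cast; ring
  have h2 : ((-Y : ℝ) : ℂ) * (u : ℂ) = ((-(Y * u) : ℝ) : ℂ) := by push_cast; ring
  have h3 : ((1 - m : ℝ) : ℂ) - 1 = -(m : ℂ) := by push_cast; ring
  have h4 : (-1 : ℂ) = ((-1 : ℝ) : ℂ) := by norm_num
  have hexp : Complex.exp (Real.pi * Complex.I * ((-a : ℝ) : ℂ)) *
      Complex.exp (Real.pi * Complex.I * ((a : ℂ) - 1)) = -1 := by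
    rw [← Complex.exp_add, show Real.pi * Complex.I * ((-a : ℝ) : ℂ) +
      Real.pi * Complex.I * ((a : ℂ) - 1) = -(Real.pi * Complex.I) by push_cast; ring,
      Complex.exp_neg, Complex.exp_pi_mul_I]
    norm_num
  have h5 : (((Y * u : ℝ) : ℂ)) ^ ((a : ℂ) - 1) = (((Y * u) ^ (a - 1) : ℝ) : ℂ) := by
    rw [Complex.ofReal_cpow hYu.le]; push_cast; rfl
  rw [h1, h2, h3, h4, Complex.ofReal_cpow_of_nonpos (by norm_num : (-1 : ℝ) ≤ 0),
    Complex.ofReal_cpow_of_nonpos (by linarith : -(Y * u) ≤ 0), Complex.cpow_neg,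
    Complex.cpow_natCast, ← Complex.ofReal_neg, neg_neg, ← Complex.ofReal_neg (-(Y * u)), neg_neg,
    h5, Complex.ofReal_one, Complex.one_cpow, one_mul]
  push_cast
  push_cast at hexp
  linear_combination (-(Y : ℂ) * (((Y * u) ^ (a - 1) : ℝ) : ℂ) * (((1 : ℂ) + Y * u) ^ m)⁻¹) * hexp

theorem one_sub_inv_pow_eq_sum {t : ℝ} (ht : 0 ≤ t) (m : ℕ) :
    1 - ((1 + t) ^ m)⁻¹ = ∑ i ∈ Finset.Icc 1 m, (m.choose i : ℝ) * (t ^ i * ((1 + t) ^ m)⁻¹) := by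
  have h0 : ((1 + t) ^ m) ≠ 0 := by positivity
  have h1 : (1 + t) ^ m = 1 + ∑ i ∈ Finset.Icc 1 m, (m.choose i : ℝ) * t ^ i := by
    rw [add_comm, add_pow, Finset.range_eq_Ico, Finset.sum_eq_sum_Ico_succ_bot (by omega)]
    simp only [pow_zero, one_pow, mul_one, Nat.choose_zero_right, Nat.cast_one, zero_add]
    congr 1
    refine Finset.sum_congr (by ext; simp) fun i _ => by ring
  simp_rw [← mul_assoc]
  rw [← Finset.sum_mul, eq_sub_of_add_eq' h1.symm, sub_mul, one_mul, mul_inv_cancel₀ h0]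

theorem intervalIntegrable_rpow_mul_inv_pow {Y b : ℝ} (hY : 0 ≤ Y) (hb : -1 < b) (m : ℕ) :
    IntervalIntegrable (fun u : ℝ => u ^ b * ((1 + Y * u) ^ m)⁻¹) volume 0 1 := by
  refine (intervalIntegral.intervalIntegrable_rpow' hb).mul_continuousOn ?_
  refine ContinuousOn.inv₀ (by fun_prop) fun u hu => ?_
  rw [Set.uIcc_of_le zero_le_one] at hu
  have := mul_nonneg hY hu.1
  positivity

/-- Termwise integration of the binomial expansion. Only `i ≥ 1` occurs and `δ < 1`, so each
exponent `i - δ - 1` exceeds `-1` and each term is integrable at `0`. -/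
theorem integral_rpow_mul_one_sub_inv_pow {Y δ : ℝ} (hY : 0 < Y) (hδ : δ < 1) (m : ℕ) :
    ∫ u in (0 : ℝ)..1, Y ^ (-δ) * (u ^ (-δ - 1) * (1 - ((1 + Y * u) ^ m)⁻¹)) =
      ∑ i ∈ Finset.Icc 1 m, (m.choose i : ℝ) *
        ∫ u in (0 : ℝ)..1, Y * ((Y * u) ^ ((i - δ : ℝ) - 1) * ((1 + Y * u) ^ m)⁻¹) := by
  have hpt : ∀ (i : ℕ) (u : ℝ), 0 < u → Y * ((Y * u) ^ ((i - δ : ℝ) - 1) * ((1 + Y * u) ^ m)⁻¹) =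
      Y ^ (i - δ : ℝ) * (u ^ (i - δ - 1 : ℝ) * ((1 + Y * u) ^ m)⁻¹) := by
    intro i u hu
    rw [Real.mul_rpow hY.le hu.le, Real.rpow_sub_one hY.ne']
    field_simp
  have hint : ∀ i ∈ Finset.Icc 1 m, IntervalIntegrable (fun u : ℝ => (m.choose i : ℝ) *
      (Y ^ (i - δ : ℝ) * (u ^ (i - δ - 1 : ℝ) * ((1 + Y * u) ^ m)⁻¹))) volume 0 1 := by
    intro i hi
    have : (1 : ℝ) ≤ i := by exact_mod_cast (Finset.mem_Icc.1 hi).1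
    exact ((intervalIntegrable_rpow_mul_inv_pow hY.le (by linarith) m).const_mul _).const_mul _
  have h1 : ∀ i ∈ Finset.Icc 1 m, (m.choose i : ℝ) *
      ∫ u in (0 : ℝ)..1, Y * ((Y * u) ^ ((i - δ : ℝ) - 1) * ((1 + Y * u) ^ m)⁻¹) =
      ∫ u in (0 : ℝ)..1, (m.choose i : ℝ) *
        (Y ^ (i - δ : ℝ) * (u ^ (i - δ - 1 : ℝ) * ((1 + Y * u) ^ m)⁻¹)) := by
    intro i _
    rw [← intervalIntegral.integral_const_mul]
    refine intervalIntegral.integral_congr_ae (Filter.Eventually.of_forall fun u hu => ?_)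
    rw [Set.uIoc_of_le zero_le_one] at hu
    rw [hpt i u hu.1]
  rw [Finset.sum_congr rfl h1, ← intervalIntegral.integral_finsetSum hint]
  refine intervalIntegral.integral_congr_ae (Filter.Eventually.of_forall fun u hu => ?_)
  rw [Set.uIoc_of_le zero_le_one] at hu
  rw [one_sub_inv_pow_eq_sum (mul_pos hY hu.1).le, Finset.mul_sum, Finset.mul_sum]
  refine Finset.sum_congr rfl fun i _ => ?_
  rw [show (i - δ : ℝ) = -δ + i by ring, show (-δ + i - 1 : ℝ) = (-δ - 1) + i by ring,
    Real.rpow_add hY, Real.rpow_add hu.1, Real.rpow_natCast, Real.rpow_natCast, mul_pow]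
  ring

theorem slantDist_sq (h r : ℝ) : slantDist h r ^ 2 = h ^ 2 + r ^ 2 :=
  Real.sq_sqrt (by positivity)

theorem hasDerivAt_slantDist_rpow {h : ℝ} (hh : 0 < h) (p y : ℝ) :
    HasDerivAt (fun y => slantDist h y ^ p) (p * y * slantDist h y ^ (p - 2)) y := by
  have h1 : HasDerivAt (slantDist h) (y / slantDist h y) y := by
    have h2 : HasDerivAt (fun y : ℝ => h ^ 2 + y ^ 2) (2 * y) y := by
      simpa using (hasDerivAt_pow 2 y).const_add (h ^ 2)
    have h3 := h2.sqrt (by positivity)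
    refine h3.congr_deriv ?_
    rw [slantDist, mul_div_mul_left _ _ two_ne_zero]
  have h2 := h1.rpow_const (p := p) (Or.inl (slantDist_pos hh y).ne')
  refine h2.congr_deriv ?_
  rw [show p - 2 = p - 1 - 1 by ring, Real.rpow_sub_one (slantDist_pos hh y).ne' (p - 1)]
  ring

theorem image_slantDist_rpow {h α r : ℝ} (hh : 0 < h) (hα : 0 < α) (hr : 0 ≤ r) :
    (fun y => slantDist h r ^ α * slantDist h y ^ (-α)) '' Set.Ioi r = Set.Ioo 0 1 := by
  set rt := slantDist h r
  have hrt : 0 < rt := slantDist_pos hh r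
  ext u
  constructor
  · rintro ⟨y, hy, rfl⟩
    have h0 : 0 < slantDist h y := slantDist_pos hh y
    have h1 : rt < slantDist h y := (slantDist_lt_slantDist_iff hr (hr.trans hy.le)).2 hy
    refine ⟨by positivity, ?_⟩
    simp only
    rw [Real.rpow_neg h0.le, ← div_eq_mul_inv, div_lt_one (by positivity)]
    exact Real.rpow_lt_rpow hrt.le h1 hα
  · rintro ⟨hu0, hu1⟩
    -- `d` solves `u = (rt / d)^α`, and the preimage is the horizontal distance `√(d² - h²)`.
    set d := rt * u ^ (-1 / α)
    have hd : rt < d := lt_mul_of_one_lt_right hrt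
      (Real.one_lt_rpow_of_pos_of_lt_one_of_neg hu0 hu1 (div_neg_of_neg_of_pos (by norm_num) hα))
    have hd2 : h ^ 2 + r ^ 2 < d ^ 2 := by
      rw [← slantDist_sq]
      exact pow_lt_pow_left₀ hd hrt.le two_ne_zero
    have hsl : slantDist h (Real.sqrt (d ^ 2 - h ^ 2)) = d := by
      rw [slantDist, Real.sq_sqrt (by nlinarith), add_sub_cancel, Real.sqrt_sq (hrt.trans hd).le]
    refine ⟨Real.sqrt (d ^ 2 - h ^ 2), Real.lt_sqrt_of_sq_lt (by linarith), ?_⟩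
    simp only [hsl]
    rw [Real.mul_rpow hrt.le (by positivity), ← Real.rpow_mul hu0.le,
      show -1 / α * -α = 1 by field_simp, Real.rpow_one, ← mul_assoc, ← Real.rpow_add hrt,
      add_neg_cancel, Real.rpow_zero, one_mul]

theorem injOn_slantDist_rpow {h α r : ℝ} (hh : 0 < h) (hα : 0 < α) (hr : 0 ≤ r) :
    Set.InjOn (fun y => slantDist h r ^ α * slantDist h y ^ (-α)) (Set.Ioi r) := by
  have hrt : 0 < slantDist h r := slantDist_pos hh r
  refine StrictAntiOn.injOn fun x hx y hy hxy => ?_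
  refine mul_lt_mul_of_pos_left ?_ (by positivity)
  refine Real.rpow_lt_rpow_of_neg (slantDist_pos hh x) ?_ (by linarith)
  exact (slantDist_lt_slantDist_iff (hr.trans (le_of_lt hx)) (hr.trans (le_of_lt hy))).2 hxy

/-- Substitute `u = (r_t / d)^α`: from `d² = r_t² u^{-2/α}` and `y dy = d(d²)/2`, the Jacobian is
`(r_t²/α) u^{-2/α-1}`. -/
theorem integral_Ioi_slantDist {h α r : ℝ} (hh : 0 < h) (hα : 0 < α) (hr : 0 ≤ r)
    (q : ℝ → ℝ) :
    ∫ y in Set.Ioi r, y * q (slantDist h r ^ α * slantDist h y ^ (-α)) =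
      ∫ u in (0 : ℝ)..1, slantDist h r ^ 2 / α * (u ^ (-(2 / α) - 1) * q u) := by
  rw [intervalIntegral.integral_of_le zero_le_one, integral_Ioc_eq_integral_Ioo,
    ← image_slantDist_rpow hh hα hr, integral_image_eq_integral_abs_deriv_smul measurableSet_Ioi
      (fun y _ => ((hasDerivAt_slantDist_rpow hh (-α) y).const_mul _).hasDerivWithinAt)
      (injOn_slantDist_rpow hh hα hr)]
  refine setIntegral_congr_fun measurableSet_Ioi fun y hy => ?_
  have hrt : 0 < slantDist h r := slantDist_pos hh r
  have hd : 0 < slantDist h y := slantDist_pos hh y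
  have hy0 : 0 < y := hr.trans_lt hy
  set rt := slantDist h r
  set d := slantDist h y
  simp only [smul_eq_mul]
  rw [show rt ^ α * (-α * y * d ^ (-α - 2)) = -(rt ^ α * (α * y * d ^ (-α - 2))) by ring, abs_neg,
    abs_of_nonneg (by positivity)]
  have h1 : (rt ^ α * d ^ (-α)) ^ (-(2 / α) - 1) = rt ^ (-2 - α) * d ^ (2 + α) := by
    rw [Real.mul_rpow (by positivity) (by positivity), ← Real.rpow_mul hrt.le,
      ← Real.rpow_mul hd.le]
    congr 2 <;> field_simp
    ring
  have h2 : rt ^ α * rt ^ (-2 - α) * rt ^ 2 = 1 := by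
    rw [← Real.rpow_natCast rt 2, ← Real.rpow_add hrt, ← Real.rpow_add hrt]
    norm_num
  have h3 : d ^ (-α - 2) * d ^ (2 + α) = 1 := by
    rw [← Real.rpow_add hd, show -α - 2 + (2 + α) = 0 by ring, Real.rpow_zero]
  rw [h1]
  calc _ = y * q (rt ^ α * d ^ (-α)) * (rt ^ α * rt ^ (-2 - α) * rt ^ 2) *
        (d ^ (-α - 2) * d ^ (2 + α)) := by rw [h2, h3]; ring
    _ = _ := by field_simp

theorem integral_one_sub_farGain (h P α : ℝ) (m : ℕ) (s : ℝ) {r : ℝ} (hr : 0 ≤ r) :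
    ∫ x, (1 - ((1 + s * farGain h P α r x / m) ^ m)⁻¹) =
      2 * Real.pi *
        ∫ y in Set.Ioi r, y * (1 - ((1 + s * P / m * slantDist h y ^ (-α)) ^ m)⁻¹) := by
  let f : ℝ → ℝ := (Set.Ioi r).indicator
    fun y => 1 - ((1 + s * P / m * slantDist h y ^ (-α)) ^ m)⁻¹
  have h1 : ∀ x : Plane, 1 - ((1 + s * farGain h P α r x / m) ^ m)⁻¹ = f ‖x‖ := by
    intro x
    rcases le_or_gt ‖x‖ r with hx | hx
    · simp [f, farGain_of_le hx, hx]
    · simp only [f, Set.indicator_of_mem (Set.mem_Ioi.2 hx), farGain_of_lt hx]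
      ring_nf
  simp_rw [h1]
  rw [integral_fun_norm_addHaar]
  have hvol : (volume : Measure Plane).real (Metric.ball 0 1) = Real.pi := by
    rw [measureReal_def, EuclideanSpace.volume_ball_fin_two]
    simp [Real.pi_pos.le]
  have h2 : ∀ y, y ^ (Module.finrank ℝ Plane - 1) • f y = (Set.Ioi r).indicator
      (fun y => y * (1 - ((1 + s * P / m * slantDist h y ^ (-α)) ^ m)⁻¹)) y := by
    intro y
    by_cases hy : y ∈ Set.Ioi r
    · simp [f, Set.indicator_of_mem hy]
    · simp [f, Set.indicator_of_notMem hy]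
  simp_rw [h2]
  rw [setIntegral_indicator measurableSet_Ioi, Set.inter_eq_self_of_subset_right
    (Set.Ioi_subset_Ioi hr), hvol]
  simp [mul_assoc]

theorem toReal_farLaplace {lam h P α s : ℝ} {m : ℕ} (hlam : 0 ≤ lam) (hm : 1 ≤ m) (hh : 0 < h)
    (hP : 0 ≤ P) (hα : 2 < α) (hs : 0 ≤ s) (r : ℝ) :
    (farLaplace lam h P α m s r).toReal =
      Real.exp (-(lam * ∫ x, (1 - ((1 + s * farGain h P α r x / m) ^ m)⁻¹))) := by
  have hle : ∀ x : Plane, 0 ≤ 1 - ((1 + s * farGain h P α r x / m) ^ m)⁻¹ := by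
    intro x
    have h0 := farGain_nonneg (h := h) (α := α) (r := r) hP x
    rw [sub_nonneg]
    refine inv_le_one_of_one_le₀ (one_le_pow₀ ?_)
    rw [le_add_iff_nonneg_right]
    positivity
  have hint : Integrable fun x : Plane => 1 - ((1 + s * farGain h P α r x / m) ^ m)⁻¹ := by
    refine ((integrable_farGain hh hP hα r).const_mul s).mono' ?_
      (Filter.Eventually.of_forall fun x => ?_)
    · have := measurable_farGain h P α r
      exact Measurable.aestronglyMeasurable (by fun_prop)
    · rw [Real.norm_of_nonneg (hle x)]
      exact one_sub_inv_pow_le (mul_nonneg hs (farGain_nonneg hP x)) hm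
  have h1 : ∀ x : Plane, 1 - ENNReal.ofReal (((1 + s * farGain h P α r x / m) ^ m)⁻¹) =
      ENNReal.ofReal (1 - ((1 + s * farGain h P α r x / m) ^ m)⁻¹) := by
    intro x
    have h0 := farGain_nonneg (h := h) (α := α) (r := r) hP x
    rw [ENNReal.ofReal_sub _ (by positivity), ENNReal.ofReal_one]
  rw [farLaplace]
  simp_rw [h1]
  rw [← ofReal_integral_eq_lintegral_ofReal hint (Filter.Eventually.of_forall hle),
    ← ENNReal.ofReal_mul hlam, expNeg_ofReal (mul_nonneg hlam (integral_nonneg hle)),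
    ENNReal.toReal_ofReal (Real.exp_nonneg _)]

/-- The closed form of the Laplace transform of the interference. -/
theorem toReal_farLaplace_eq_laplaceExpression {lam h P α s r : ℝ} {m : ℕ} (hlam : 0 ≤ lam)
    (hm : 1 ≤ m) (hh : 0 < h) (hP : 0 < P) (hα : 2 < α) (hs : 0 ≤ s) (hr : 0 ≤ r) :
    ((farLaplace lam h P α m s r).toReal : ℂ) =
      laplaceExpression lam P α m s (slantDist h r) := by
  have hα0 : 0 < α := by linarith
  have hm0 : (0 : ℝ) < m := by positivity
  have hrt : 0 < slantDist h r := slantDist_pos hh r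
  rw [toReal_farLaplace hlam hm hh hP.le hα hs, integral_one_sub_farGain h P α m s hr,
    laplaceExpression, Complex.ofReal_exp]
  congr 1
  rw [Complex.ofReal_neg]
  congr 1
  -- At `s = 0` both exponents vanish, the explicit one through `0 ^ (2/α) = 0`; the substitutions
  -- below need `s > 0`.
  rcases hs.eq_or_lt with rfl | hs
  · have h0 : (0 : ℝ) ^ (2 / α) = 0 := Real.zero_rpow (by positivity)
    simp [h0]
  set rt := slantDist h r
  set c := s * P / m
  have hc : 0 < c := by positivity
  set Y := c * rt ^ (-α)
  have hY : 0 < Y := by positivity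
  have hYz : -(s * P) / (m * rt ^ α) = -Y := by
    simp only [Y, c]
    rw [Real.rpow_neg hrt.le]
    field_simp
  have hq := integral_Ioi_slantDist hh hα0 hr (fun u => 1 - ((1 + Y * u) ^ m)⁻¹)
  have harg : ∀ y, Y * (rt ^ α * slantDist h y ^ (-α)) = c * slantDist h y ^ (-α) := by
    intro y
    simp only [Y]
    rw [Real.rpow_neg hrt.le]
    field_simp
  rw [show slantDist h r = rt from rfl] at hq
  simp only [harg] at hq
  -- This trades the Jacobian's `rt²` for the prefactor `(sP/m)^δ`.
  have hcY : c ^ (2 / α) * Y ^ (-(2 / α)) = rt ^ 2 := by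
    simp only [Y]
    rw [Real.mul_rpow hc.le (by positivity), ← mul_assoc, ← Real.rpow_add hc, add_neg_cancel,
      Real.rpow_zero, one_mul, ← Real.rpow_mul hrt.le, show -α * -(2 / α) = (2 : ℕ) by
        push_cast; field_simp, Real.rpow_natCast]
  have hsum := integral_rpow_mul_one_sub_inv_pow hY (δ := 2 / α) (by rwa [div_lt_one hα0]) m
  have hmain : ∫ y in Set.Ioi r, y * (1 - ((1 + c * slantDist h y ^ (-α)) ^ m)⁻¹) =
      c ^ (2 / α) / α * ∑ i ∈ Finset.Icc 1 m, (m.choose i : ℝ) *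
        ∫ u in (0 : ℝ)..1, Y * ((Y * u) ^ ((i - 2 / α : ℝ) - 1) * ((1 + Y * u) ^ m)⁻¹) := by
    rw [hq, ← hsum, ← intervalIntegral.integral_const_mul]
    congr 1
    ext u
    rw [← hcY]
    ring
  rw [hmain, hYz]
  have hterm : ∀ i : ℕ, (-1 : ℂ) ^ (((2 / α - i : ℝ)) : ℂ) *
      incompleteBeta ((-Y : ℝ) : ℂ) ((i - 2 / α : ℝ) : ℂ) ((1 - m : ℝ) : ℂ) =
      ((∫ u in (0 : ℝ)..1, Y * ((Y * u) ^ ((i - 2 / α : ℝ) - 1) * ((1 + Y * u) ^ m)⁻¹) : ℝ) : ℂ) :=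
    fun i => by rw [← neg_one_cpow_mul_incompleteBeta hY, neg_sub]
  simp_rw [mul_assoc, hterm]
  push_cast
  simp_rw [Finset.mul_sum]
  refine Finset.sum_congr rfl fun i _ => ?_
  ring

/-! ### Conditioning on the nearest distance -/

/-- Right continuity holds because the excluded ball is closed: a point beyond `t` is eventually
beyond `ρ n`, and one within `t` is never counted. -/
theorem tendsto_farGain {h P α t : ℝ} {ρ : ℕ → ℝ} (hρ : ∀ n, t ≤ ρ n)
    (hρt : Filter.Tendsto ρ Filter.atTop (nhds t)) (x : Plane) :
    Filter.Tendsto (fun n => farGain h P α (ρ n) x) Filter.atTop (nhds (farGain h P α t x)) := by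
  rcases le_or_gt ‖x‖ t with hx | hx
  · simp only [farGain_of_le hx, farGain_of_le (hx.trans (hρ _))]
    exact tendsto_const_nhds
  · refine tendsto_const_nhds.congr' ?_
    filter_upwards [hρt.eventually_lt_const hx] with n hn
    rw [farGain_of_lt hn, farGain_of_lt hx]

section

variable {Ω : Type*} [MeasurableSpace Ω] {μ : Measure Ω} {lam : ℝ} {X : ℕ → Ω → Plane}
  {m : ℕ} {g : ℕ → Ω → ℝ} {h P α : ℝ}

/-- Almost surely, the interference is right continuous in the distance from which it is counted. -/
theorem ae_tendsto_interference [IsProbabilityMeasure μ]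
    (hX : IsHomogeneousPoissonProcess μ lam X) (hg : IsNakagamiFading μ m X g)
    (hlam : 0 ≤ lam) (hm : 1 ≤ m) (hh : 0 < h) (hP : 0 ≤ P) (hα : 2 < α) :
    ∀ᵐ ω ∂μ, ∀ (t : ℝ) (ρ : ℕ → ℝ), 0 ≤ t → (∀ n, t ≤ ρ n) →
      Filter.Tendsto ρ Filter.atTop (nhds t) →
      Filter.Tendsto (fun n => interference X g h P α (slantDist h (ρ n)) ω) Filter.atTop
        (nhds (interference X g h P α (slantDist h t) ω)) := by
  filter_upwards [ae_summable_farGain hX hg hlam hm hh hP hα] with ω hω t ρ ht hρ hρt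
  simp only [interference, interferenceTerm_slantDist ht,
    interferenceTerm_slantDist (ht.trans (hρ _))]
  refine tendsto_tsum_of_dominated_convergence (hω.2 t (by linarith))
    (fun j => (tendsto_farGain hρ hρt _).mul_const _) (Filter.Eventually.of_forall fun n j => ?_)
  rw [Real.norm_of_nonneg (mul_nonneg (farGain_nonneg hP _) (hω.1 j))]
  exact mul_le_mul_of_nonneg_right (farGain_antitone hP _ (hρ n)) (hω.1 j)

theorem ae_interference_nonneg (hg : IsNakagamiFading μ m X g) (hP : 0 ≤ P) :
    ∀ᵐ ω ∂μ, ∀ t, 0 ≤ t → 0 ≤ interference X g h P α (slantDist h t) ω := by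
  filter_upwards [hg.ae_nonneg] with ω hω t ht
  refine tsum_nonneg fun j => ?_
  rw [interferenceTerm_slantDist ht]
  exact mul_nonneg (farGain_nonneg hP _) (hω j)

theorem measurable_interference (hX : ∀ j, Measurable (X j)) (hg : ∀ j, Measurable (g j))
    {T : Ω → ℝ} (hT : Measurable T) :
    Measurable fun ω => interference X g h P α (slantDist h (T ω)) ω := by
  refine Measurable.tsum fun j => ?_
  have h1 : Measurable fun ω => slantDist h ‖X j ω‖ := (measurable_slantDist h).comp (hX j).norm
  have h2 : Measurable fun ω => slantDist h (T ω) := (measurable_slantDist h).comp hT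
  exact Measurable.ite (measurableSet_lt h2 h1) (((hg j).mul_const P).mul (h1.pow_const (-α)))
    measurable_const

theorem measurable_ofReal_exp_neg_interference (hX : ∀ j, Measurable (X j))
    (hg : ∀ j, Measurable (g j)) {T : Ω → ℝ} (hT : Measurable T) (s : ℝ) :
    Measurable fun ω =>
      ENNReal.ofReal (Real.exp (-(s * interference X g h P α (slantDist h (T ω)) ω))) :=
  ((measurable_interference hX hg hT).const_mul s).neg.exp.ennreal_ofReal

/-- Monotonicity supplies the measurability in the radius. -/
theorem farLaplace_monotone {s : ℝ} (hP : 0 ≤ P) (hs : 0 ≤ s) :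
    Monotone (farLaplace lam h P α m s) := by
  intro r t hrt
  refine antitone_expNeg (mul_le_mul_right (lintegral_mono fun x => ?_) _)
  refine tsub_le_tsub_left (ENNReal.ofReal_le_ofReal ?_) 1
  have h0 := farGain_nonneg (h := h) (α := α) (r := t) hP x
  refine inv_anti₀ (by positivity) (pow_le_pow_left₀ (by positivity) ?_ m)
  have := farGain_antitone (h := h) (α := α) hP x hrt
  gcongr

theorem tendsto_setLIntegral_exp_neg_interference [IsProbabilityMeasure μ]
    (hX : IsHomogeneousPoissonProcess μ lam X) (hg : IsNakagamiFading μ m X g)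
    (hlam : 0 ≤ lam) (hm : 1 ≤ m) (hh : 0 < h) (hP : 0 ≤ P) (hα : 2 < α) {s : ℝ} (hs : 0 ≤ s)
    {T : Ω → ℝ} {ρ : ℕ → Ω → ℝ} (hT : ∀ ω, 0 ≤ T ω) (hρm : ∀ n, Measurable (ρ n)) (A : Set Ω)
    (hA : MeasurableSet A) (hρ : ∀ n, ∀ ω ∈ A, T ω ≤ ρ n ω)
    (hρt : ∀ ω ∈ A, Filter.Tendsto (fun n => ρ n ω) Filter.atTop (nhds (T ω))) :
    Filter.Tendsto (fun n => ∫⁻ ω in A, ENNReal.ofReal (Real.exp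
      (-(s * interference X g h P α (slantDist h (ρ n ω)) ω))) ∂μ) Filter.atTop
      (nhds (∫⁻ ω in A, ENNReal.ofReal (Real.exp
        (-(s * interference X g h P α (slantDist h (T ω)) ω))) ∂μ)) := by
  refine tendsto_lintegral_of_dominated_convergence (fun _ => 1)
    (fun n => measurable_ofReal_exp_neg_interference hX.measurable hg.measurable (hρm n) s)
    (fun n => ?_) (by simp) ?_
  · filter_upwards [ae_restrict_of_ae (ae_interference_nonneg (h := h) (α := α) hg hP),
      ae_restrict_mem hA] with ω hω hωA
    rw [ENNReal.ofReal_le_one, Real.exp_le_one_iff, neg_nonpos]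
    exact mul_nonneg hs (hω _ ((hT ω).trans (hρ n ω hωA)))
  · filter_upwards [ae_restrict_of_ae (ae_tendsto_interference hX hg hlam hm hh hP hα),
      ae_restrict_mem hA] with ω hω hωA
    have h1 := hω (T ω) (fun n => ρ n ω) (hT ω) (fun n => hρ n ω hωA) (hρt ω hωA)
    exact ENNReal.tendsto_ofReal ((Real.continuous_exp.tendsto _).comp (h1.const_mul s).neg)

/-- Right continuity is inherited from the interference, since `farLaplace` is its Laplace transform
at a fixed radius. -/
theorem tendsto_farLaplace [IsProbabilityMeasure μ]
    (hX : IsHomogeneousPoissonProcess μ lam X) (hg : IsNakagamiFading μ m X g)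
    (hlam : 0 ≤ lam) (hm : 1 ≤ m) (hh : 0 < h) (hP : 0 ≤ P) (hα : 2 < α) {s t : ℝ} (hs : 0 ≤ s)
    (ht : 0 ≤ t) {ρ : ℕ → ℝ} (hρ : ∀ n, t ≤ ρ n) (hρt : Filter.Tendsto ρ Filter.atTop (nhds t)) :
    Filter.Tendsto (fun n => farLaplace lam h P α m s (ρ n)) Filter.atTop
      (nhds (farLaplace lam h P α m s t)) := by
  have := tendsto_setLIntegral_exp_neg_interference hX hg hlam hm hh hP hα hs
    (T := fun _ => t) (ρ := fun n _ => ρ n) (fun _ => ht) (fun n => measurable_const) Set.univ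
    MeasurableSet.univ (fun n _ _ => hρ n) (fun _ _ => hρt)
  simpa only [Measure.restrict_univ, lintegral_exp_neg_interference hX hg hlam hm hh hP hα ht hs,
    lintegral_exp_neg_interference hX hg hlam hm hh hP hα (ht.trans (hρ _)) hs] using this

/-- The right end point of the cell of the grid `a + ℕ / (n + 1)` that contains `t`. -/
noncomputable def gridCeil (a : ℝ) (n : ℕ) (t : ℝ) : ℝ :=
  a + (⌊(t - a) * (n + 1)⌋₊ + 1) / (n + 1)

theorem measurable_gridCeil (a : ℝ) (n : ℕ) : Measurable (gridCeil a n) := by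
  have h1 : Measurable fun t : ℝ => ⌊(t - a) * (n + 1)⌋₊ :=
    Nat.measurable_floor.comp (by fun_prop)
  have h2 : Measurable fun t : ℝ => ((⌊(t - a) * (n + 1)⌋₊ : ℕ) : ℝ) :=
    measurable_from_top.comp h1
  exact ((h2.add_const 1).div_const _).const_add a

theorem lt_gridCeil (a : ℝ) (n : ℕ) (t : ℝ) : t < gridCeil a n t := by
  have h1 := Nat.lt_floor_add_one ((t - a) * (n + 1))
  rw [← lt_div_iff₀ (by positivity)] at h1
  rw [gridCeil]
  linarith

theorem gridCeil_le {a t : ℝ} (hat : a ≤ t) (n : ℕ) : gridCeil a n t ≤ t + 1 / (n + 1) := by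
  have h1 := Nat.floor_le (a := (t - a) * (n + 1)) (mul_nonneg (by linarith) (by positivity))
  rw [← div_le_iff₀ (by positivity)] at h1
  rw [gridCeil, add_div]
  linarith

theorem tendsto_gridCeil {a t : ℝ} (hat : a ≤ t) :
    Filter.Tendsto (fun n => gridCeil a n t) Filter.atTop (nhds t) := by
  refine tendsto_of_tendsto_of_tendsto_of_le_of_le tendsto_const_nhds ?_
    (fun n => (lt_gridCeil a n t).le) (fun n => gridCeil_le hat n)
  simpa using (tendsto_one_div_add_atTop_nhds_zero_nat (𝕜 := ℝ)).const_add t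

theorem mem_Ico_grid_iff {a t : ℝ} (hat : a ≤ t) (n k : ℕ) :
    t ∈ Set.Ico (a + k / (n + 1)) (a + (k + 1) / (n + 1)) ↔ ⌊(t - a) * (n + 1)⌋₊ = k := by
  rw [Nat.floor_eq_iff (mul_nonneg (by linarith) (by positivity)), Set.mem_Ico,
    ← div_le_iff₀ (by positivity), ← lt_div_iff₀ (by positivity), le_sub_iff_add_le',
    sub_lt_iff_lt_add']

/-- On each cell the rounded distance is constant, equal to the right end point, so the identity for
`a ≤ R < b` applies cell by cell. -/
theorem setLIntegral_exp_neg_interference_gridCeil [IsProbabilityMeasure μ]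
    (hX : IsHomogeneousPoissonProcess μ lam X) (hg : IsNakagamiFading μ m X g)
    (hlam : 0 ≤ lam) (hm : 1 ≤ m) (hh : 0 < h) (hP : 0 ≤ P) (hα : 2 < α) {a s : ℝ}
    (ha : 0 ≤ a) (hs : 0 ≤ s) (n : ℕ) :
    ∫⁻ ω in nearestHorizontalDist X ⁻¹' Set.Ici a, ENNReal.ofReal (Real.exp (-(s *
        interference X g h P α (slantDist h (gridCeil a n (nearestHorizontalDist X ω))) ω))) ∂μ =
      ∫⁻ ω in nearestHorizontalDist X ⁻¹' Set.Ici a,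
        farLaplace lam h P α m s (gridCeil a n (nearestHorizontalDist X ω)) ∂μ := by
  have hR := measurable_nearestHorizontalDist hX.measurable
  let C : ℕ → Set ℝ := fun k => Set.Ico (a + k / (n + 1)) (a + (k + 1) / (n + 1))
  have hCa : ∀ k, ∀ t ∈ C k, a ≤ t := fun k t ht =>
    (le_add_of_nonneg_right (by positivity)).trans ht.1
  have hCU : Set.Ici a = ⋃ k, C k := by
    ext t
    simp only [Set.mem_iUnion, Set.mem_Ici]
    exact ⟨fun ht => ⟨_, (mem_Ico_grid_iff ht n _).2 rfl⟩, fun ⟨k, hk⟩ => hCa k t hk⟩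
  have hCd : Pairwise (Function.onFun Disjoint fun k => nearestHorizontalDist X ⁻¹' C k) := by
    intro k l hkl
    refine Disjoint.preimage _ (Set.disjoint_left.2 fun t hk hl => hkl ?_)
    rw [← (mem_Ico_grid_iff (hCa k t hk) n k).1 hk, (mem_Ico_grid_iff (hCa k t hk) n l).1 hl]
  have hCm : ∀ k, MeasurableSet (nearestHorizontalDist X ⁻¹' C k) := fun k => hR measurableSet_Ico
  have hgrid : ∀ k, ∀ t ∈ C k, gridCeil a n t = a + (k + 1) / (n + 1) := by
    intro k t ht
    rw [gridCeil, (mem_Ico_grid_iff (hCa k t ht) n k).1 ht]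
  rw [hCU, Set.preimage_iUnion, lintegral_iUnion hCm hCd, lintegral_iUnion hCm hCd]
  refine tsum_congr fun k => ?_
  have h1 := setLIntegral_exp_neg_interference_Ico hX hg hlam hm hh hP hα
    (a := a + k / (n + 1)) (b := a + (k + 1) / (n + 1)) (s := s) (by gcongr; linarith)
    (by positivity) hs
  rw [← setLIntegral_const] at h1
  rw [setLIntegral_congr_fun (hCm k) (fun ω hω => by rw [hgrid k _ hω]), h1]
  exact setLIntegral_congr_fun (hCm k) (fun ω hω => by rw [hgrid k _ hω])

theorem setLIntegral_exp_neg_interference_nearest [IsProbabilityMeasure μ]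
    (hX : IsHomogeneousPoissonProcess μ lam X) (hg : IsNakagamiFading μ m X g)
    (hlam : 0 ≤ lam) (hm : 1 ≤ m) (hh : 0 < h) (hP : 0 ≤ P) (hα : 2 < α) {s : ℝ}
    (hs : 0 ≤ s) {B : Set ℝ} (hB : MeasurableSet B) :
    ∫⁻ ω in nearestHorizontalDist X ⁻¹' B, ENNReal.ofReal (Real.exp (-(s *
        interference X g h P α (slantDist h (nearestHorizontalDist X ω)) ω))) ∂μ =
      ∫⁻ ω in nearestHorizontalDist X ⁻¹' B,
        farLaplace lam h P α m s (nearestHorizontalDist X ω) ∂μ := by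
  have hR := measurable_nearestHorizontalDist hX.measurable
  have hLm := (farLaplace_monotone (lam := lam) (h := h) (α := α) (m := m) hP hs).measurable
  have hIci : ∀ a, 0 ≤ a →
      ∫⁻ ω in nearestHorizontalDist X ⁻¹' Set.Ici a, ENNReal.ofReal (Real.exp (-(s *
        interference X g h P α (slantDist h (nearestHorizontalDist X ω)) ω))) ∂μ =
      ∫⁻ ω in nearestHorizontalDist X ⁻¹' Set.Ici a,
        farLaplace lam h P α m s (nearestHorizontalDist X ω) ∂μ := by
    intro a ha
    have hA : MeasurableSet (nearestHorizontalDist X ⁻¹' Set.Ici a) := hR measurableSet_Ici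
    refine tendsto_nhds_unique (tendsto_setLIntegral_exp_neg_interference hX hg hlam hm hh hP hα hs
      (ρ := fun n ω => gridCeil a n (nearestHorizontalDist X ω)) (nearestHorizontalDist_nonneg X)
      (fun n => (measurable_gridCeil a n).comp hR) _ hA
      (fun n ω _ => (lt_gridCeil a n _).le) (fun ω hω => tendsto_gridCeil hω)) ?_
    simp_rw [setLIntegral_exp_neg_interference_gridCeil hX hg hlam hm hh hP hα ha hs]
    refine tendsto_lintegral_of_dominated_convergence (fun _ => 1)
      (fun n => hLm.comp ((measurable_gridCeil a n).comp hR))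
      (fun n => Filter.Eventually.of_forall fun ω => expNeg_le_one _) (by simp) ?_
    filter_upwards [ae_restrict_mem hA] with ω hω
    exact tendsto_farLaplace hX hg hlam hm hh hP hα hs (nearestHorizontalDist_nonneg X ω)
      (fun n => (lt_gridCeil a n _).le) (tendsto_gridCeil hω)
  have hΦm := measurable_ofReal_exp_neg_interference (h := h) (P := P) (α := α) hX.measurable
    hg.measurable hR s
  set Φ : Ω → ℝ≥0∞ := fun ω => ENNReal.ofReal (Real.exp (-(s *
    interference X g h P α (slantDist h (nearestHorizontalDist X ω)) ω)))
  set Λ : Ω → ℝ≥0∞ := fun ω => farLaplace lam h P α m s (nearestHorizontalDist X ω)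
  have happly : ∀ (f : Ω → ℝ≥0∞) {B : Set ℝ}, MeasurableSet B →
      (μ.withDensity f).map (nearestHorizontalDist X) B =
        ∫⁻ ω in nearestHorizontalDist X ⁻¹' B, f ω ∂μ := fun f B hB => by
    rw [Measure.map_apply hR hB, withDensity_apply _ (hR hB)]
  have hfin : IsFiniteMeasure ((μ.withDensity Λ).map (nearestHorizontalDist X)) := by
    refine ⟨?_⟩
    rw [happly _ MeasurableSet.univ]
    refine (lintegral_mono fun ω => expNeg_le_one _).trans_lt ?_
    simp
  -- Both sides are measures on the line, the left one finite, so agreement on closed half-lines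
  -- suffices; a half-line starting below `0` is no different from `[0, ∞)`.
  have hmeas : (μ.withDensity Λ).map (nearestHorizontalDist X) =
      (μ.withDensity Φ).map (nearestHorizontalDist X) := by
    refine Measure.ext_of_Ici _ _ fun a => ?_
    rw [happly _ measurableSet_Ici, happly _ measurableSet_Ici]
    rcases le_or_gt 0 a with ha | ha
    · exact (hIci a ha).symm
    · have : nearestHorizontalDist X ⁻¹' Set.Ici a = nearestHorizontalDist X ⁻¹' Set.Ici 0 := by
        ext ω
        have := nearestHorizontalDist_nonneg X ω
        simp [this, ha.le.trans this]
      rw [this]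
      exact (hIci 0 le_rfl).symm
  rw [← happly _ hB, ← happly _ hB, hmeas]

/-- The Laplace transform of the interference conditional on the distance to the nearest UAV. -/
theorem condExp_exp_neg_interference_nearest [IsProbabilityMeasure μ]
    (hX : IsHomogeneousPoissonProcess μ lam X) (hg : IsNakagamiFading μ m X g)
    (hlam : 0 ≤ lam) (hm : 1 ≤ m) (hh : 0 < h) (hP : 0 ≤ P) (hα : 2 < α) {s : ℝ} (hs : 0 ≤ s) :
    (fun ω => (farLaplace lam h P α m s (nearestHorizontalDist X ω)).toReal) =ᵐ[μ]
      μ[fun ω => Real.exp (-(s *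
          interference X g h P α (slantDist h (nearestHorizontalDist X ω)) ω)) |
        MeasurableSpace.comap (nearestHorizontalDist X) inferInstance] := by
  have hR := measurable_nearestHorizontalDist hX.measurable
  have hLm : Measurable fun r => (farLaplace lam h P α m s r).toReal :=
    (farLaplace_monotone hP hs).measurable.ennreal_toReal
  have hEm : Measurable fun ω => Real.exp (-(s *
      interference X g h P α (slantDist h (nearestHorizontalDist X ω)) ω)) :=
    ((measurable_interference hX.measurable hg.measurable hR).const_mul s).neg.exp
  have hint : Integrable (fun ω => Real.exp (-(s *
      interference X g h P α (slantDist h (nearestHorizontalDist X ω)) ω))) μ := by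
    refine Integrable.of_bound hEm.aestronglyMeasurable 1 ?_
    filter_upwards [ae_interference_nonneg (h := h) (α := α) hg hP] with ω hω
    rw [Real.norm_of_nonneg (Real.exp_nonneg _), Real.exp_le_one_iff, neg_nonpos]
    exact mul_nonneg hs (hω _ (nearestHorizontalDist_nonneg X ω))
  have hintL : Integrable
      (fun ω => (farLaplace lam h P α m s (nearestHorizontalDist X ω)).toReal) μ := by
    refine Integrable.of_bound (hLm.comp hR).aestronglyMeasurable 1
      (Filter.Eventually.of_forall fun ω => ?_)
    rw [Real.norm_of_nonneg ENNReal.toReal_nonneg]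
    exact ENNReal.toReal_le_of_le_ofReal zero_le_one (by rw [ENNReal.ofReal_one]; exact expNeg_le_one _)
  refine ae_eq_condExp_of_forall_setIntegral_eq hR.comap_le hint
    (fun _ _ _ => hintL.integrableOn) ?_ ?_
  · rintro _ ⟨B, hB, rfl⟩ -
    rw [integral_eq_lintegral_of_nonneg_ae (Filter.Eventually.of_forall fun _ =>
        ENNReal.toReal_nonneg) (hLm.comp hR).aestronglyMeasurable,
      integral_eq_lintegral_of_nonneg_ae (Filter.Eventually.of_forall fun _ =>
        Real.exp_nonneg _) hEm.aestronglyMeasurable,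
      setLIntegral_exp_neg_interference_nearest hX hg hlam hm hh hP hα hs hB]
    simp_rw [farLaplace, ENNReal.ofReal_toReal (expNeg_ne_top _)]
  · exact (hLm.comp (comap_measurable _)).aestronglyMeasurable

end

theorem lemma2 {Ω : Type*} [MeasurableSpace Ω] (μ : Measure Ω) [IsProbabilityMeasure μ]
    (lam P α h : ℝ) (m : ℕ) (hlam : 0 < lam) (hP : 0 < P) (hα : 2 < α) (hh : 0 < h) (hm : 1 ≤ m)
    (X : ℕ → Ω → Plane) (g : ℕ → Ω → ℝ)
    (hX : IsHomogeneousPoissonProcess μ lam X) (hg : IsNakagamiFading μ m X g) :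
    -- a given serving distance `rt = √(h² + r²)`
    (∀ r : ℝ, 0 ≤ r →
      (∀ᵐ ω ∂μ, Summable (interferenceTerm X g h P α (slantDist h r) ω)) ∧
      ∀ s : ℝ, 0 ≤ s →
        ((∫ ω, Real.exp (-(s * interference X g h P α (slantDist h r) ω)) ∂μ : ℝ) : ℂ) =
          laplaceExpression lam P α m s (slantDist h r)) ∧
    -- the random distance to the nearest UAV: Laplace transform conditional on that distance
    ((∀ᵐ ω ∂μ, Summable
        (interferenceTerm X g h P α (slantDist h (nearestHorizontalDist X ω)) ω)) ∧
      ∀ s : ℝ, 0 ≤ s →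
        ∀ᵐ ω ∂μ,
          (((μ[fun ω' => Real.exp (-(s *
              interference X g h P α (slantDist h (nearestHorizontalDist X ω')) ω')) |
            MeasurableSpace.comap (nearestHorizontalDist X) inferInstance]) ω : ℝ) : ℂ) =
          laplaceExpression lam P α m s (slantDist h (nearestHorizontalDist X ω))) := by
  -- The null set does not depend on `r`, so the random nearest distance may be substituted.
  have hsum : ∀ᵐ ω ∂μ, ∀ r, 0 ≤ r → Summable (interferenceTerm X g h P α (slantDist h r) ω) := by
    filter_upwards [ae_summable_farGain hX hg hlam.le hm hh hP.le hα] with ω hω r hr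
    exact (hω.2 r (by linarith)).congr fun j => (interferenceTerm_slantDist hr ω j).symm
  refine ⟨fun r hr => ⟨?_, fun s hs => ?_⟩, ?_, fun s hs => ?_⟩
  · filter_upwards [hsum] with ω hω using hω r hr
  · rw [← toReal_farLaplace_eq_laplaceExpression hlam.le hm hh hP hα hs hr,
      ← lintegral_exp_neg_interference hX hg hlam.le hm hh hP.le hα hr hs,
      integral_eq_lintegral_of_nonneg_ae (Filter.Eventually.of_forall fun _ => Real.exp_nonneg _)]
    exact ((measurable_interference hX.measurable hg.measurable
      measurable_const).const_mul s).neg.exp.aestronglyMeasurable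
  · filter_upwards [hsum] with ω hω using hω _ (nearestHorizontalDist_nonneg X ω)
  · filter_upwards [condExp_exp_neg_interference_nearest hX hg hlam.le hm hh hP.le hα hs] with ω hω
    rw [← hω, toReal_farLaplace_eq_laplaceExpression hlam.le hm hh hP hα hs
      (nearestHorizontalDist_nonneg X ω)]
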